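/- Let $d\ge 2$ and $n\ge d+1$, let $t_1<\dots<t_n$ be any real numbers, let $v_i=(t_i,t_i^2,\dots,t_i^d)\in\mathbb R^d$, and let $C(n,d)=\operatorname{conv}\{v_1,\dots,v_n\}$ be the cyclic polytope. Let $\pi:\mathbb R^d\to\mathbb R$, $\pi(x)=x_1$, be the projection to the first coordinate, which maps $C(n,d)$ onto $C(n,1)=[t_1,t_n]$. A monotone edge path on $C(n,d)$ is a sequence $\sigma=(F_1,\dots,F_k)$ of edges of $C(n,d)$ with $v_1\in F_1$, $v_n\in F_k$ and $\max\pi(F_r)=\min\pi(F_{r+1})$ for $1\le r<k$. Its sign vector is $\lambda_\sigma=(\lambda_2,\dots,\lambda_{n-1})\in\{+,-\}^{n-2}$, where $\lambda_i=-$ if $v_i$ is an endpoint of some $F_r$, and $\lambda_i=+$ otherwise. For a linear functional $f$ on $\mathbb R^d$ and $q\in\pi(C(n,d))$, let $F_q$ be the smallest face of $C(n,d)$ containing the set of all points at which $f$ attains its minimum over the fiber $C(n,d)\cap\pi^{-1}(q)$. The path $\sigma$ is $\pi$-coherent if for some $f$ the edges $F_1,\dots,F_k$ are exactly the inclusion-maximal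 members of the family $\{F_q: q\in\pi(C(n,d))\}$. For $\lambda\in\{+,-\}^{n-2}$ let $c(\lambda)$ be the number of maximal strings of successive $+$ signs or successive $-$ signs in $\lambda$. Then for every $\lambda\in\{+,-\}^{n-2}$, there is a $\pi$-coherent monotone edge path $\sigma$ on $C(n,d)$ with $\lambda=\lambda_\sigma$ if and only if $c(\lambda)\le d-1$. Moreover, the number of $\pi$-coherent monotone edge paths on $C(n,d)$ is $$2\sum_{j=0}^{d-2}\binom{n-3}{j}.$$ -/

import Mathlib

noncomputable section

/-- The point `(x, x², …, x^d)` of the moment curve in `ℝ^d`. -/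
def momentPoint (d : ℕ) (x : ℝ) : EuclideanSpace ℝ (Fin d) :=
  WithLp.toLp 2 fun i => x ^ (i.val + 1)

/-- The cyclic polytope `C(n,d)` with parameters `t 0 < ⋯ < t (n-1)`. -/
def cyclicPolytope (d : ℕ) {n : ℕ} (t : Fin n → ℝ) : Set (EuclideanSpace ℝ (Fin d)) :=
  convexHull ℝ (Set.range fun i => momentPoint d (t i))

/-- The projection `ℝ^d → ℝ` that forgets all coordinates but the first. It maps `C(n,d)` onto
`C(n,1)`. -/
def firstCoord {d : ℕ} (hd : 2 ≤ d) : EuclideanSpace ℝ (Fin d) →ₗ[ℝ] ℝ where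
  toFun x := x ⟨0, by omega⟩
  map_add' _ _ := rfl
  map_smul' _ _ := rfl

section Polytope

variable {E : Type*} [NormedAddCommGroup E] [NormedSpace ℝ E]

/-- Nonempty faces of a polytope `P` (including `P`): the sets of points of `P` at which some
linear functional attains its maximum over `P`. -/
def IsPolytopeFace (P F : Set E) : Prop :=
  F.Nonempty ∧ IsExposed ℝ P F

/-- Edges: one-dimensional faces. -/
def IsPolytopeEdge (P F : Set E) : Prop :=
  IsPolytopeFace P F ∧ Module.finrank ℝ (vectorSpan ℝ F) = 1

/-- The face of the fiber `P ∩ π⁻¹(q)` on which `f` is minimized. -/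
def fiberMinFace (P : Set E) (π f : E →ₗ[ℝ] ℝ) (q : ℝ) : Set E :=
  {x | (x ∈ P ∧ π x = q) ∧ ∀ y, y ∈ P ∧ π y = q → f x ≤ f y}

/-- The `π`-coherent subdivision of `π(P)` induced by `f`, as the family `{F_q}` of faces of `P`,
where `F_q` is the smallest face of `P` containing the `f`-minimal face of the fiber over `q`
(equivalently, the face whose relative interior contains the relative interior of that
`f`-minimal face). -/
def coherentSubdivision (P : Set E) (π f : E →ₗ[ℝ] ℝ) : Set (Set E) :=
  {F | ∃ q ∈ π '' P, IsLeast {G | IsPolytopeFace P G ∧ fiberMinFace P π f q ⊆ G} F}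

/-- A cellular string on `P` with respect to `π`, from the vertex `a` to the vertex `b`: a sequence
`(F_1, …, F_k)` of faces with `a ∈ F_1`, `b ∈ F_k` and `max π(F_i) = min π(F_{i+1})`. -/
structure IsCellularString (P : Set E) (π : E →ₗ[ℝ] ℝ) (a b : E) (σ : List (Set E)) : Prop where
  face : ∀ F ∈ σ, IsPolytopeFace P F
  first : ∃ F ∈ σ.head?, a ∈ F
  last : ∃ F ∈ σ.getLast?, b ∈ F
  chain : σ.IsChain fun F G => ∃ c, IsGreatest (π '' F) c ∧ IsLeast (π '' G) c

/-- A cellular string is coherent if its faces are the maximal cells of a `π`-coherent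
subdivision. -/
def IsCoherentString (P : Set E) (π : E →ₗ[ℝ] ℝ) (σ : List (Set E)) : Prop :=
  ∃ f : E →ₗ[ℝ] ℝ, ∀ F, F ∈ σ ↔ Maximal (· ∈ coherentSubdivision P π f) F

open Classical in
/-- The sign vector `(λ_2, …, λ_{n-1})` of a cellular string on a polytope with vertices
`v_1, …, v_n` (here `v 0, …, v (n-1)`): `+` if the vertex does not appear in the string, `-` if
it is the initial or terminal vertex of some face in the string, and `0` otherwise. -/
def stringSign {n : ℕ} (π : E →ₗ[ℝ] ℝ) (v : Fin n → E) (σ : List (Set E)) :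
    Fin (n - 2) → SignType := fun i =>
  let w := v ⟨i.val + 1, by omega⟩
  if ∀ F ∈ σ, w ∉ F then 1
  else if ∃ F ∈ σ, w ∈ F ∧ ((∀ x ∈ F, π w ≤ π x) ∨ (∀ x ∈ F, π x ≤ π w)) then -1
  else 0

end Polytope

/-- A monotone edge path on `C(n,d)`: a cellular string from the first to the last vertex all of
whose faces are edges. -/
def IsMonotoneEdgePath {n d : ℕ} (hd : 2 ≤ d) (hn : d + 1 ≤ n) (t : Fin n → ℝ)
    (σ : List (Set (EuclideanSpace ℝ (Fin d)))) : Prop :=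
  IsCellularString (cyclicPolytope d t) (firstCoord hd)
    (momentPoint d (t ⟨0, by omega⟩)) (momentPoint d (t ⟨n - 1, by omega⟩)) σ ∧
  ∀ F ∈ σ, IsPolytopeEdge (cyclicPolytope d t) F

/-- The set of `π`-coherent monotone edge paths on `C(n,d)`. -/
def coherentMonotoneEdgePaths {n d : ℕ} (hd : 2 ≤ d) (hn : d + 1 ≤ n) (t : Fin n → ℝ) :
    Set (List (Set (EuclideanSpace ℝ (Fin d)))) :=
  {σ | IsMonotoneEdgePath hd hn t σ ∧ IsCoherentString (cyclicPolytope d t) (firstCoord hd) σ}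

/-- The number of maximal strings of successive equal entries of a sign vector. -/
def numRuns {m : ℕ} (s : Fin m → SignType) : ℕ :=
  Set.ncard {I : Set (Fin m) |
    Maximal (fun J => J.Nonempty ∧ J.OrdConnected ∧ ∀ i ∈ J, ∀ j ∈ J, s i = s j) I}

end

/-!
A linear functional `f` on `ℝ^d` restricts to the moment curve as a polynomial `p` of degree at most
`d`, so it lifts the parameters `t k` to planar points `(t k, p (t k))`. The fiberwise minima of `f`
on the cyclic polytope project to the lower convex hull of these points. The maximal cells of the
coherent subdivision are therefore edges exactly when no hull line contains three of the points, and
then they join neighbouring hull vertices (`HasLowerHull.maximal_iff`, `hasLowerHull_of_maximal`).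
Coherent monotone edge paths thus correspond to the sets `A` of vertices that are such generic lower
hulls of some `p`, and the sign vector of the path records the complement of `A`.

It remains to see which `A` occur. A vertex of the hull forces a positive second difference of `p`
there, and a gap of the hull with skipped points forces a negative one inside the gap. These are
values of `p''` at increasing points, so `p''`, of degree at most `d - 2`, has a root for every
switch between `+` and `-` (`HasLowerHull.numChanges_le`).

Conversely, `A` is a lower hull when finitely many strict linear inequalities on `f` hold. If they
have no solution, separation from the origin gives a convex combination `μ` of them, a weight on the
grid, that annihilates all polynomials of degree at most `d`. By Taylor's formula
`∑ μ l * p (t l) = ∫ H * p''` with `H x = ∑ μ l * (t l - x)⁺`. The kernel `H` is nonnegative at the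
points of `A` and convex on each gap, so its sign changes are bounded by the switches of the sign
vector. If there are at most `d - 2` of these, a polynomial `p''` that changes sign together with `H`
makes the integral positive, a contradiction (`exists_polynomial_gridPairing_pos`,
`exists_linear_hasLowerHull`).

Sign vectors have one run more than switches (`numRuns_eq`), and they are determined by the first
sign and the set of switches among `n - 3` places, which gives the count.
-/

/-! ### Lower hulls of planar point sequences -/

/-- `Consecutive A i j`: the indices `i < j` are neighbouring elements of `A`. -/
def Consecutive (A : Finset ℕ) (i j : ℕ) : Prop :=
  i ∈ A ∧ j ∈ A ∧ i < j ∧ ∀ k, i < k → k < j → k ∉ A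

/-- The signed height of the point `(t k, w k)` above the line through `(t i, w i)` and
`(t j, w j)`, multiplied by `t j - t i`. -/
def chordExcess (t w : ℕ → ℝ) (i j k : ℕ) : ℝ :=
  (t j - t i) * w k - (t j - t k) * w i - (t k - t i) * w j

/-- For `0, N ∈ A`: the indices of the points `(t k, w k)`, `k ≤ N`, that lie on the lower convex
hull are those in `A`, and no three of these points are on a common line of that hull. -/
def HasLowerHull (t : ℕ → ℝ) (N : ℕ) (A : Finset ℕ) (w : ℕ → ℝ) : Prop :=
  ∀ i j, Consecutive A i j → ∀ k ≤ N, k ≠ i → k ≠ j → 0 < chordExcess t w i j k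

/-- The number of places at which the sequence `1 ∈ A, 2 ∈ A, …, m + 1 ∈ A` of truth values
changes. -/
def numChanges (A : Finset ℕ) (m : ℕ) : ℕ :=
  ((Finset.range m).filter fun k => ¬ (k + 1 ∈ A ↔ k + 2 ∈ A)).card

theorem Consecutive.le_or_le {A : Finset ℕ} {i j a : ℕ} (h : Consecutive A i j) (ha : a ∈ A) :
    a ≤ i ∨ j ≤ a := by
  by_contra! hc
  exact h.2.2.2 a hc.1 hc.2 ha

theorem exists_consecutive {A : Finset ℕ} {N k : ℕ} (h0 : 0 ∈ A) (hN : N ∈ A) (hk : k < N) :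
    ∃ i j, Consecutive A i j ∧ i ≤ k ∧ k < j := by
  have h1 : (A.filter (· ≤ k)).Nonempty := ⟨0, by simp [h0]⟩
  have h2 : (A.filter (k < ·)).Nonempty := ⟨N, by simp [hN, hk]⟩
  have m1 := Finset.max'_mem _ h1
  have m2 := Finset.min'_mem _ h2
  simp only [Finset.mem_filter] at m1 m2
  refine ⟨_, _, ⟨m1.1, m2.1, lt_of_le_of_lt m1.2 m2.2, fun l hl hl' hA => ?_⟩, m1.2, m2.2⟩
  rcases le_or_gt l k with h | h
  · exact absurd (Finset.le_max' (A.filter (· ≤ k)) l (by simp [hA, h])) (not_le.2 hl)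
  · exact absurd (Finset.min'_le (A.filter (k < ·)) l (by simp [hA, h])) (not_le.2 hl')

/-! ### Sign changes forced by a polynomial -/

section

open Polynomial

/-- A polynomial that has prescribed strict signs along a monotone sequence has at least as many
roots as there are sign changes. -/
theorem card_changes_le_natDegree (r : ℝ[X]) (Q : ℕ → Prop) [DecidablePred Q] (m : ℕ) (e : ℕ → ℝ)
    (he : ∀ k < m, e k ≤ e (k + 1)) (hpos : ∀ k ≤ m, Q k → 0 < r.eval (e k))
    (hneg : ∀ k ≤ m, ¬ Q k → r.eval (e k) < 0) :
    ((Finset.range m).filter fun k => ¬ (Q k ↔ Q (k + 1))).card ≤ r.natDegree := by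
  have hr : r ≠ 0 := by
    rintro rfl
    by_cases h : Q 0
    · simpa using hpos 0 (Nat.zero_le _) h
    · simpa using hneg 0 (Nat.zero_le _) h
  have key : ∀ k, ∃ ρ, k < m → ¬ (Q k ↔ Q (k + 1)) →
      e k < ρ ∧ ρ < e (k + 1) ∧ r.eval ρ = 0 := by
    intro k
    by_cases hk : k < m ∧ ¬ (Q k ↔ Q (k + 1))
    · obtain ⟨hk, hQ⟩ := hk
      have hc : ContinuousOn (fun x => r.eval x) (Set.Icc (e k) (e (k + 1))) :=
        r.continuous.continuousOn
      by_cases h : Q k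
      · have h' : ¬ Q (k + 1) := fun h' => hQ (by simp [h, h'])
        obtain ⟨ρ, hρ, h0⟩ := intermediate_value_Ioo' (he k hk) hc
          (show (0 : ℝ) ∈ _ from ⟨hneg _ hk h', hpos _ hk.le h⟩)
        exact ⟨ρ, fun _ _ => ⟨hρ.1, hρ.2, h0⟩⟩
      · have h' : Q (k + 1) := by by_contra h'; exact hQ (by simp [h, h'])
        obtain ⟨ρ, hρ, h0⟩ := intermediate_value_Ioo (he k hk) hc
          (show (0 : ℝ) ∈ _ from ⟨hneg _ hk.le h, hpos _ hk h'⟩)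
        exact ⟨ρ, fun _ _ => ⟨hρ.1, hρ.2, h0⟩⟩
    · exact ⟨0, fun h1 h2 => absurd ⟨h1, h2⟩ hk⟩
  choose ρ hρ using key
  have hmono : ∀ a b, a ≤ b → b ≤ m → e a ≤ e b := by
    intro a b hab
    induction b, hab using Nat.le_induction with
    | base => intro _; exact le_rfl
    | succ b _ ih => intro hb; exact (ih (by omega)).trans (he b (by omega))
  have hlt : ∀ a b, a < b → b < m → ¬ (Q a ↔ Q (a + 1)) → ¬ (Q b ↔ Q (b + 1)) → ρ a < ρ b := by
    intro a b hab hb ha' hb'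
    exact ((hρ a (hab.trans hb) ha').2.1.trans_le (hmono _ _ hab hb.le)).trans (hρ b hb hb').1
  calc _ ≤ r.roots.toFinset.card := by
        refine Finset.card_le_card_of_injOn ρ ?_ ?_
        · intro k hk
          simp only [Finset.coe_filter, Finset.mem_range, Set.mem_ofPred_eq] at hk
          simp [hr, (hρ k hk.1 hk.2).2.2]
        · intro a ha b hb hab
          simp only [Finset.coe_filter, Finset.mem_range, Set.mem_ofPred_eq] at ha hb
          rcases lt_trichotomy a b with h | h | h
          · exact absurd hab (hlt a b h hb.1 ha.2 hb.2).ne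
          · exact h
          · exact absurd hab (hlt b a h ha.1 hb.2 ha.2).ne'
    _ ≤ r.roots.card := Multiset.toFinset_card_le _
    _ ≤ r.natDegree := r.card_roots'

theorem exists_eval_derivative_eq (p : ℝ[X]) {a b : ℝ} (hab : a < b) :
    ∃ c, a < c ∧ c < b ∧ p.derivative.eval c * (b - a) = p.eval b - p.eval a := by
  obtain ⟨c, hc, h⟩ := exists_deriv_eq_slope (fun x => p.eval x) hab p.continuous.continuousOn
    p.differentiable.differentiableOn
  refine ⟨c, hc.1, hc.2, ?_⟩
  rw [Polynomial.deriv] at h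
  rw [h, div_mul_cancel₀ _ (sub_pos.2 hab).ne']

/-- Second differences of a polynomial at consecutive triples of a grid have the signs of its
second derivative at increasing points. Sampling the first derivative once in every grid interval
is what keeps these points in order, although neighbouring triples overlap. -/
theorem exists_strictMono_second_derivative {t : ℕ → ℝ} (ht : StrictMono t) (p : ℝ[X]) :
    ∃ ξ : ℕ → ℝ, StrictMono ξ ∧ ∀ k,
      (chordExcess t (fun l => p.eval (t l)) k (k + 2) (k + 1) < 0 →
        0 < p.derivative.derivative.eval (ξ k)) ∧
      (0 < chordExcess t (fun l => p.eval (t l)) k (k + 2) (k + 1) →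
        p.derivative.derivative.eval (ξ k) < 0) := by
  choose η h1 h2 h3 using fun k => exists_eval_derivative_eq p (ht (Nat.lt_succ_self k))
  choose ξ g1 g2 g3 using fun k =>
    exists_eval_derivative_eq p.derivative ((h2 k).trans (h1 (k + 1)))
  refine ⟨ξ, strictMono_nat_of_lt_succ fun k => (g2 k).trans (g1 (k + 1)), fun k => ?_⟩
  have e1 := h3 k
  have e2 := h3 (k + 1)
  have e3 := g3 k
  have p1 : 0 < t (k + 1) - t k := sub_pos.2 (ht (by omega))
  have p2 : 0 < t (k + 2) - t (k + 1) := sub_pos.2 (ht (by omega))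
  have p3 : 0 < η (k + 1) - η k := sub_pos.2 ((h2 k).trans (h1 (k + 1)))
  have hE : chordExcess t (fun l => p.eval (t l)) k (k + 2) (k + 1) =
      -(p.derivative.derivative.eval (ξ k) *
        ((η (k + 1) - η k) * ((t (k + 1) - t k) * (t (k + 2) - t (k + 1))))) := by
    have e2' : p.derivative.eval (η (k + 1)) * (t (k + 2) - t (k + 1)) =
      p.eval (t (k + 2)) - p.eval (t (k + 1)) := e2
    have e1' : p.derivative.eval (η k) * (t (k + 1) - t k) =
      p.eval (t (k + 1)) - p.eval (t k) := e1
    rw [← mul_assoc, e3]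
    simp only [chordExcess]
    linear_combination (t (k + 1) - t k) * e2' - (t (k + 2) - t (k + 1)) * e1'
  have hP := mul_pos p3 (mul_pos p1 p2)
  rw [hE]
  constructor
  · intro h
    exact pos_of_mul_pos_left (neg_lt_zero.1 h) hP.le
  · intro h
    by_contra! hc
    have := mul_nonneg hc hP.le
    linarith

/-- If some point strictly between two points lies strictly above their chord, then the leftmost
point farthest above the chord is a strictly concave corner. -/
theorem exists_concave_corner {t w : ℕ → ℝ} (ht : StrictMono t) {i j k : ℕ} (hik : i < k)
    (hkj : k < j) (h : 0 < chordExcess t w i j k) :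
    ∃ m, i ≤ m ∧ m + 1 < j ∧ 0 < chordExcess t w m (m + 2) (m + 1) := by
  obtain ⟨M, hM, hmax⟩ := Finset.exists_max_image (Finset.Icc i j) (chordExcess t w i j)
    ⟨k, by simp; omega⟩
  have hne : ((Finset.Icc i j).filter
      fun l => chordExcess t w i j l = chordExcess t w i j M).Nonempty := ⟨M, by simpa using hM⟩
  obtain ⟨q, hq, hmin⟩ := Finset.exists_min_image _ id hne
  simp only [Finset.mem_filter, Finset.mem_Icc, id, and_imp] at hq hmin hmax
  have hpos : 0 < chordExcess t w i j q := hq.2 ▸ h.trans_le (hmax k hik.le hkj.le)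
  have hqi : q ≠ i := by
    rintro rfl
    simp [chordExcess] at hpos
  have hqj : q ≠ j := by
    rintro rfl
    simp [chordExcess] at hpos
  obtain ⟨m, rfl⟩ : ∃ m, q = m + 1 := ⟨q - 1, by omega⟩
  refine ⟨m, by omega, by omega, ?_⟩
  have h1 : chordExcess t w i j m < chordExcess t w i j (m + 1) := by
    refine lt_of_le_of_ne (hq.2 ▸ hmax m (by omega) (by omega)) fun hE => ?_
    have := hmin m (by omega) (by omega) (hE.trans hq.2)
    omega
  have h2 : chordExcess t w i j (m + 2) ≤ chordExcess t w i j (m + 1) :=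
    hq.2 ▸ hmax (m + 2) (by omega) (by omega)
  have p0 : 0 < t j - t i := sub_pos.2 (ht (by omega))
  have p1 : 0 < t (m + 1) - t m := sub_pos.2 (ht (by omega))
  have p2 : 0 < t (m + 2) - t (m + 1) := sub_pos.2 (ht (by omega))
  have a1 := mul_pos p2 (sub_pos.2 h1)
  have a2 := mul_nonneg p1.le (sub_nonneg.2 h2)
  have hE : (t j - t i) * chordExcess t w m (m + 2) (m + 1) =
      (t (m + 2) - t (m + 1)) * (chordExcess t w i j (m + 1) - chordExcess t w i j m) +
      (t (m + 1) - t m) * (chordExcess t w i j (m + 1) - chordExcess t w i j (m + 2)) := by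
    simp only [chordExcess]; ring
  exact pos_of_mul_pos_right (hE ▸ add_pos_of_pos_of_nonneg a1 a2) p0.le

theorem HasLowerHull.convex_corner {t w : ℕ → ℝ} (ht : StrictMono t) {A : Finset ℕ} {N k : ℕ}
    (h : HasLowerHull t N A w) (h0 : 0 ∈ A) (hN : N ∈ A) (hk : k + 1 < N) (hkA : k + 1 ∈ A) :
    chordExcess t w k (k + 2) (k + 1) < 0 := by
  obtain ⟨i, j, hc, hi, hj⟩ := exists_consecutive h0 hN hk
  obtain rfl : i = k + 1 := by
    rcases hc.le_or_le hkA with h | h <;> omega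
  have h1 : 0 < chordExcess t w (k + 1) j k := h _ _ hc k (by omega) (by omega) (by omega)
  have h2 : 0 ≤ chordExcess t w (k + 1) j (k + 2) := by
    by_cases hj' : k + 2 = j
    · subst hj'; simp [chordExcess]
    · exact (h _ _ hc _ (by omega) (by omega) hj').le
  have p0 : 0 < t j - t (k + 1) := sub_pos.2 (ht (by omega))
  have p1 : 0 < t (k + 1) - t k := sub_pos.2 (ht (by omega))
  have p2 : 0 < t (k + 2) - t (k + 1) := sub_pos.2 (ht (by omega))
  have hE : (t j - t (k + 1)) * (-chordExcess t w k (k + 2) (k + 1)) =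
      (t (k + 2) - t (k + 1)) * chordExcess t w (k + 1) j k +
      (t (k + 1) - t k) * chordExcess t w (k + 1) j (k + 2) := by
    simp only [chordExcess]; ring
  have := pos_of_mul_pos_right
    (hE ▸ add_pos_of_pos_of_nonneg (mul_pos p2 h1) (mul_nonneg p1.le h2)) p0.le
  linarith

/-- The lower hull of points on the graph of a polynomial of degree `D` switches at most `D - 2`
times between using and skipping points. -/
theorem HasLowerHull.numChanges_le {t : ℕ → ℝ} (ht : StrictMono t) {A : Finset ℕ} {m : ℕ}
    (p : ℝ[X]) (h0 : 0 ∈ A) (hN : m + 2 ∈ A)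
    (h : HasLowerHull t (m + 2) A fun k => p.eval (t k)) :
    numChanges A m ≤ p.natDegree - 2 := by
  obtain ⟨ξ, hξ, hsign⟩ := exists_strictMono_second_derivative ht p
  have hgap : ∀ k, ∃ i j, k < m + 2 → Consecutive A i j ∧ i ≤ k ∧ k < j := by
    intro k
    by_cases hk : k < m + 2
    · obtain ⟨i, j, h⟩ := exists_consecutive h0 hN hk
      exact ⟨i, j, fun _ => h⟩
    · exact ⟨0, 0, fun h => absurd h hk⟩
  choose I J hIJ using hgap
  have hcorner : ∀ i j, ∃ q, Consecutive A i j → j ≤ m + 2 → (∃ k, i < k ∧ k < j) →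
      i ≤ q ∧ q + 1 < j ∧
        0 < chordExcess t (fun k => p.eval (t k)) q (q + 2) (q + 1) := by
    intro i j
    by_cases hc : Consecutive A i j ∧ j ≤ m + 2 ∧ ∃ k, i < k ∧ k < j
    · obtain ⟨hc, hj, k, hik, hkj⟩ := hc
      obtain ⟨q, hq⟩ := exists_concave_corner ht hik hkj
        (h i j hc k (by omega) (by omega) (by omega))
      exact ⟨q, fun _ _ _ => hq⟩
    · exact ⟨0, fun h1 h2 h3 => absurd ⟨h1, h2, h3⟩ hc⟩
  choose M hM using hcorner
  -- A vertex represents itself; a skipped point is represented by the concave corner of its gap.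
  let rep : ℕ → ℕ := fun k => if k + 1 ∈ A then k else M (I (k + 1)) (J (k + 1))
  have hrep : ∀ k ≤ m, k + 1 ∉ A → I (k + 1) ≤ k ∧ k + 1 < J (k + 1) ∧
      Consecutive A (I (k + 1)) (J (k + 1)) ∧ I (k + 1) ≤ rep k ∧ rep k + 1 < J (k + 1) ∧
      0 < chordExcess t (fun k => p.eval (t k)) (rep k) (rep k + 2) (rep k + 1) := by
    intro k hk hkA
    obtain ⟨hc, h1, h2⟩ := hIJ (k + 1) (by omega)
    have h1' : I (k + 1) ≠ k + 1 := fun hE => hkA (hE ▸ hc.1)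
    have hJ : J (k + 1) ≤ m + 2 := by
      rcases hc.le_or_le hN with h | h <;> omega
    have := hM _ _ hc hJ ⟨k + 1, by omega, h2⟩
    refine ⟨by omega, h2, hc, ?_⟩
    simpa only [rep, if_neg hkA] using this
  have hmono : ∀ k < m, rep k ≤ rep (k + 1) := by
    intro k hk
    by_cases hA : k + 1 ∈ A <;> by_cases hB : k + 2 ∈ A
    · simp [rep, hA, hB]
    · obtain ⟨_, h2, hc, h4, -⟩ := hrep (k + 1) (by omega) hB
      have h5 : rep k = k := by simp [rep, hA]
      rcases hc.le_or_le hA with h | h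
      · simp only [show k + 1 + 1 = k + 2 from rfl] at *
        omega
      · simp only [show k + 1 + 1 = k + 2 from rfl] at *
        omega
    · obtain ⟨_, h2, hc, h4, h5, -⟩ := hrep k (by omega) hA
      have h6 : rep (k + 1) = k + 1 := by simp [rep, hB]
      rcases hc.le_or_le hB with h | h <;> omega
    · obtain ⟨a1, a2, hc, -⟩ := hrep k (by omega) hA
      obtain ⟨b1, b2, hc', -⟩ := hrep (k + 1) (by omega) hB
      simp only [show k + 1 + 1 = k + 2 from rfl] at *
      have hI : I (k + 1) = I (k + 2) := by
        rcases hc.le_or_le hc'.1 with h | h <;> rcases hc'.le_or_le hc.1 with h' | h' <;> omega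
      have hJ : J (k + 1) = J (k + 2) := by
        rcases hc.le_or_le hc'.2.1 with h | h <;> rcases hc'.le_or_le hc.2.1 with h' | h' <;> omega
      simp [rep, hA, hB, hI, hJ]
  have := card_changes_le_natDegree p.derivative.derivative (fun k => k + 1 ∈ A) m
    (fun k => ξ (rep k)) (fun k hk => hξ.monotone (hmono k hk))
    (fun k hk hA => by
      have : rep k = k := by simp [rep, hA]
      rw [this]
      exact (hsign k).1 (h.convex_corner ht h0 hN (by omega) hA))
    (fun k hk hA => (hsign _).2 (hrep k hk hA).2.2.2.2.2)
  have hd1 := natDegree_derivative_le p.derivative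
  have hd2 := natDegree_derivative_le p
  exact this.trans (by omega)

end

/-! ### Polynomials with prescribed sign changes -/

section

open Polynomial

/-- A function with constant weak sign on each of `m + 1` successive intervals has the weak sign of
some nonzero polynomial whose degree is at most the number of sign changes. -/
theorem exists_polynomial_mul_nonneg (H : ℝ → ℝ) (Q : ℕ → Prop) [DecidablePred Q] (τ : ℕ → ℝ)
    (m : ℕ) (hτ : ∀ k ≤ m, τ k ≤ τ (k + 1))
    (hpos : ∀ k ≤ m, Q k → ∀ x, τ k < x → x < τ (k + 1) → 0 ≤ H x)
    (hneg : ∀ k ≤ m, ¬ Q k → ∀ x, τ k < x → x < τ (k + 1) → H x ≤ 0) :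
    ∃ r : ℝ[X], r ≠ 0 ∧
      r.natDegree ≤ ((Finset.range m).filter fun k => ¬ (Q k ↔ Q (k + 1))).card ∧
      (∀ x, τ m ≤ x → (Q m → 0 ≤ r.eval x) ∧ (¬ Q m → r.eval x ≤ 0)) ∧
      ∀ x, τ 0 < x → x < τ (m + 1) → (∀ k ≤ m, x ≠ τ k) → 0 ≤ r.eval x * H x := by
  induction m with
  | zero =>
    by_cases h : Q 0
    · exact ⟨1, one_ne_zero, by simp, by simp [h], fun x h1 h2 _ => by
        simpa using hpos 0 le_rfl h x h1 h2⟩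
    · exact ⟨-1, by simp, by simp, by simp [h], fun x h1 h2 _ => by
        simpa using hneg 0 le_rfl h x h1 h2⟩
  | succ m ih =>
    obtain ⟨r, hr, hdeg, htail, hH⟩ := ih (fun k hk => hτ k (by omega))
      (fun k hk => hpos k (by omega)) (fun k hk => hneg k (by omega))
    have hlast := hτ m (by omega)
    by_cases hQ : Q m ↔ Q (m + 1)
    · refine ⟨r, hr, ?_, ?_, ?_⟩
      · simpa [Finset.range_add_one, Finset.filter_insert, hQ] using hdeg
      · intro x hx
        rw [← hQ]
        exact htail x (hlast.trans hx)
      · intro x h0 h1 hne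
        rcases lt_or_gt_of_ne (hne (m + 1) le_rfl) with h | h
        · exact hH x h0 h fun k hk => hne k (by omega)
        · have ht := htail x (hlast.trans h.le)
          by_cases hq : Q (m + 1)
          · exact mul_nonneg (ht.1 (hQ.2 hq)) (hpos _ le_rfl hq x h h1)
          · exact mul_nonneg_of_nonpos_of_nonpos (ht.2 (fun h => hq (hQ.1 h)))
              (hneg _ le_rfl hq x h h1)
    · refine ⟨r * (C (τ (m + 1)) - X), ?_, ?_, ?_, ?_⟩
      · refine mul_ne_zero hr fun h => ?_
        have := congrArg (eval (τ (m + 1) + 1)) h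
        simp at this
      · have h1 : (C (τ (m + 1)) - X : ℝ[X]).natDegree ≤ 1 :=
          (natDegree_sub_le _ _).trans (by simp)
        have h2 := natDegree_mul_le (p := r) (q := C (τ (m + 1)) - X)
        have h3 : ((Finset.range (m + 1)).filter fun k => ¬ (Q k ↔ Q (k + 1))).card =
            ((Finset.range m).filter fun k => ¬ (Q k ↔ Q (k + 1))).card + 1 := by
          rw [Finset.range_add_one, Finset.filter_insert, if_pos hQ,
            Finset.card_insert_of_notMem (by simp)]
        omega
      · intro x hx
        have ht := htail x (hlast.trans hx)
        simp only [eval_mul, eval_sub, eval_C, eval_X]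
        constructor
        · intro hq
          exact mul_nonneg_of_nonpos_of_nonpos (ht.2 fun h => hQ (by simp [h, hq])) (by linarith)
        · intro hq
          have hq' : Q m := by by_contra h; exact hQ (by simp [h, hq])
          exact mul_nonpos_of_nonneg_of_nonpos (ht.1 hq') (by linarith)
      · intro x h0 h1 hne
        simp only [eval_mul, eval_sub, eval_C, eval_X]
        rcases lt_or_gt_of_ne (hne (m + 1) le_rfl) with h | h
        · rw [mul_right_comm]
          exact mul_nonneg (hH x h0 h fun k hk => hne k (by omega)) (by linarith)
        · have ht := htail x (hlast.trans h.le)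
          by_cases hq : Q (m + 1)
          · exact mul_nonneg (mul_nonneg_of_nonpos_of_nonpos
              (ht.2 fun h => hQ (by simp [h, hq])) (by linarith)) (hpos _ le_rfl hq x h h1)
          · have hq' : Q m := by by_contra h; exact hQ (by simp [h, hq])
            exact mul_nonneg_of_nonpos_of_nonpos (mul_nonpos_of_nonneg_of_nonpos
              (ht.1 hq') (by linarith)) (hneg _ le_rfl hq x h h1)

theorem exists_derivative_eq (r : ℝ[X]) :
    ∃ p : ℝ[X], p.derivative = r ∧ p.natDegree ≤ r.natDegree + 1 := by
  refine ⟨∑ k ∈ Finset.range (r.natDegree + 1), monomial (k + 1) (r.coeff k / (k + 1)), ?_, ?_⟩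
  · conv_rhs => rw [r.as_sum_range]
    rw [derivative_sum]
    refine Finset.sum_congr rfl fun k _ => ?_
    rw [derivative_monomial]
    have : (k : ℝ) + 1 ≠ 0 := by positivity
    simp [this]
  · refine natDegree_sum_le_of_forall_le _ _ fun k hk => (natDegree_monomial_le _).trans ?_
    have := Finset.mem_range.1 hk
    omega

/-- Taylor's formula with integral remainder, written over a fixed interval. -/
theorem integral_hinge_mul_derivative (p : ℝ[X]) {a b y : ℝ} (hay : a ≤ y) (hyb : y ≤ b) :
    ∫ x in a..b, max (y - x) 0 * p.derivative.derivative.eval x =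
      p.eval y - p.eval a - (y - a) * p.derivative.eval a := by
  have hc : Continuous fun x => max (y - x) 0 * p.derivative.derivative.eval x := by fun_prop
  rw [← intervalIntegral.integral_add_adjacent_intervals (hc.intervalIntegrable a y)
    (hc.intervalIntegrable y b)]
  have h2 : ∫ x in y..b, max (y - x) 0 * p.derivative.derivative.eval x = 0 := by
    rw [intervalIntegral.integral_congr (g := fun _ => 0)]
    · simp
    · intro x hx
      rw [Set.uIcc_of_le hyb] at hx
      simp [max_eq_right (sub_nonpos.2 hx.1)]
  have h1 : ∫ x in a..y, max (y - x) 0 * p.derivative.derivative.eval x =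
      ∫ x in a..y, (y - x) * p.derivative.derivative.eval x := by
    refine intervalIntegral.integral_congr fun x hx => ?_
    rw [Set.uIcc_of_le hay] at hx
    simp [max_eq_left (sub_nonneg.2 hx.2)]
  have h3 : ∫ x in a..y, (-1 : ℝ) * p.derivative.eval x = -(p.eval y - p.eval a) := by
    rw [intervalIntegral.integral_const_mul,
      intervalIntegral.integral_eq_sub_of_hasDerivAt (fun x _ => p.hasDerivAt x)
        (p.derivative.continuous.intervalIntegrable _ _)]
    ring
  rw [h1, h2, intervalIntegral.integral_mul_deriv_eq_deriv_mul (u' := fun _ => -1)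
    (v := fun x => p.derivative.eval x)
    (fun x _ => by simpa using (hasDerivAt_id x).const_sub y)
    (fun x _ => p.derivative.hasDerivAt x) (by simp)
    (p.derivative.derivative.continuous.intervalIntegrable _ _), h3]
  ring

end

/-! ### Signed weights on a grid -/

/-- The functional `μ ↦ ∑ w l * μ l` (sum over `l ≤ N`) on signed weights. -/
def gridPairing (N : ℕ) (w : ℕ → ℝ) : (ℕ → ℝ) →ₗ[ℝ] ℝ :=
  ∑ l ∈ Finset.range (N + 1), w l • LinearMap.proj l

theorem gridPairing_apply (N : ℕ) (w μ : ℕ → ℝ) :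
    gridPairing N w μ = ∑ l ∈ Finset.range (N + 1), w l * μ l := by
  simp [gridPairing]

/-- The weights whose pairing with `w` is `chordExcess t w i j k`. -/
def chordWeights (t : ℕ → ℝ) (i j k : ℕ) : ℕ → ℝ :=
  (t j - t i) • Pi.single k 1 - (t j - t k) • Pi.single i 1 - (t k - t i) • Pi.single j 1

theorem gridPairing_single {N k : ℕ} (w : ℕ → ℝ) (hk : k ≤ N) :
    gridPairing N w (Pi.single k 1) = w k := by
  rw [gridPairing_apply, Finset.sum_eq_single k]
  · simp
  · intro b _ hb; simp [hb]
  · intro h; exact absurd (Finset.mem_range.2 (by omega)) h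

theorem gridPairing_chordWeights {N i j k : ℕ} (t w : ℕ → ℝ) (hi : i ≤ N) (hj : j ≤ N)
    (hk : k ≤ N) : gridPairing N w (chordWeights t i j k) = chordExcess t w i j k := by
  simp [chordWeights, gridPairing_single, hi, hj, hk, chordExcess]

/-- The kernel `x ↦ ∑ μ l * (t l - x)⁺` that represents the weights `μ` on second derivatives. -/
def hingeSum (t : ℕ → ℝ) (N : ℕ) (μ : ℕ → ℝ) (x : ℝ) : ℝ :=
  gridPairing N (fun l => max (t l - x) 0) μ

theorem hingeSum_apply (t : ℕ → ℝ) (N : ℕ) (μ : ℕ → ℝ) (x : ℝ) :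
    hingeSum t N μ x = ∑ l ∈ Finset.range (N + 1), max (t l - x) 0 * μ l :=
  gridPairing_apply _ _ _

theorem continuous_hingeSum (t : ℕ → ℝ) (N : ℕ) (μ : ℕ → ℝ) : Continuous (hingeSum t N μ) := by
  simp only [funext (hingeSum_apply t N μ)]
  fun_prop

theorem hingeSum_last {t : ℕ → ℝ} (ht : StrictMono t) (N : ℕ) (μ : ℕ → ℝ) :
    hingeSum t N μ (t N) = 0 := by
  rw [hingeSum_apply]
  refine Finset.sum_eq_zero fun l hl => ?_
  have := ht.monotone (Nat.lt_succ_iff.1 (Finset.mem_range.1 hl))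
  simp [max_eq_right (sub_nonpos.2 this)]

theorem hingeSum_first {t : ℕ → ℝ} (ht : StrictMono t) {N : ℕ} {μ : ℕ → ℝ}
    (h0 : gridPairing N (fun _ => 1) μ = 0) (h1 : gridPairing N t μ = 0) :
    hingeSum t N μ (t 0) = 0 := by
  have : hingeSum t N μ (t 0) = gridPairing N t μ - t 0 * gridPairing N (fun _ => 1) μ := by
    simp only [hingeSum_apply, gridPairing_apply, Finset.mul_sum, ← Finset.sum_sub_distrib]
    refine Finset.sum_congr rfl fun l _ => ?_
    rw [max_eq_left (sub_nonneg.2 (ht.monotone (Nat.zero_le l)))]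
    ring
  rw [this, h0, h1]; simp

theorem gridPairing_eval_eq_integral {t : ℕ → ℝ} (ht : StrictMono t) {N : ℕ} {μ : ℕ → ℝ}
    (h0 : gridPairing N (fun _ => 1) μ = 0) (h1 : gridPairing N t μ = 0) (p : Polynomial ℝ) :
    gridPairing N (fun l => p.eval (t l)) μ =
      ∫ x in t 0..t N, hingeSum t N μ x * p.derivative.derivative.eval x := by
  have hI : ∀ l ∈ Finset.range (N + 1),
      ∫ x in t 0..t N, μ l * (max (t l - x) 0 * p.derivative.derivative.eval x) =
      μ l * (p.eval (t l) - p.eval (t 0) - (t l - t 0) * p.derivative.eval (t 0)) := by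
    intro l hl
    rw [intervalIntegral.integral_const_mul, integral_hinge_mul_derivative p
      (ht.monotone (Nat.zero_le l)) (ht.monotone (Nat.lt_succ_iff.1 (Finset.mem_range.1 hl)))]
  have : ∀ x, hingeSum t N μ x * p.derivative.derivative.eval x =
      ∑ l ∈ Finset.range (N + 1),
        μ l * (max (t l - x) 0 * p.derivative.derivative.eval x) := by
    intro x
    rw [hingeSum_apply, Finset.sum_mul]
    exact Finset.sum_congr rfl fun l _ => by ring
  simp only [this]
  rw [intervalIntegral.integral_finsetSum fun l _ =>
    Continuous.intervalIntegrable (by fun_prop) _ _, Finset.sum_congr rfl hI]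
  have : ∑ l ∈ Finset.range (N + 1),
      μ l * (p.eval (t l) - p.eval (t 0) - (t l - t 0) * p.derivative.eval (t 0)) =
      gridPairing N (fun l => p.eval (t l)) μ
        - (p.eval (t 0) - t 0 * p.derivative.eval (t 0)) * gridPairing N (fun _ => 1) μ
        - p.derivative.eval (t 0) * gridPairing N t μ := by
    simp only [gridPairing_apply, Finset.mul_sum, ← Finset.sum_sub_distrib]
    exact Finset.sum_congr rfl fun l _ => by ring
  rw [this, h0, h1]; ring

theorem hingeSum_nonneg_between {t : ℕ → ℝ} (ht : StrictMono t) {N : ℕ} {μ : ℕ → ℝ} {k : ℕ}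
    (h0 : 0 ≤ hingeSum t N μ (t k)) (h1 : 0 ≤ hingeSum t N μ (t (k + 1))) {x : ℝ}
    (hx : t k ≤ x) (hx' : x ≤ t (k + 1)) : 0 ≤ hingeSum t N μ x := by
  have hlt : 0 < t (k + 1) - t k := sub_pos.2 (ht (by omega))
  have : (t (k + 1) - t k) * hingeSum t N μ x =
      (t (k + 1) - x) * hingeSum t N μ (t k) + (x - t k) * hingeSum t N μ (t (k + 1)) := by
    simp only [hingeSum_apply, Finset.mul_sum, ← Finset.sum_add_distrib]
    refine Finset.sum_congr rfl fun l _ => ?_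
    rcases le_or_gt l k with h | h
    · have := ht.monotone h
      rw [max_eq_right (by linarith), max_eq_right (by linarith), max_eq_right (by linarith)]
      ring
    · have := ht.monotone h
      simp only [Nat.succ_eq_add_one] at this
      rw [max_eq_left (by linarith), max_eq_left (by linarith), max_eq_left (by linarith)]
      ring
  exact nonneg_of_mul_nonneg_right (this ▸ add_nonneg (mul_nonneg (by linarith) h0)
    (mul_nonneg (by linarith) h1)) hlt

theorem convexOn_hingeSum {t : ℕ → ℝ} (ht : StrictMono t) {N : ℕ} {μ : ℕ → ℝ} {i j : ℕ}
    (hμ : ∀ k ≤ N, i < k → k < j → 0 ≤ μ k) :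
    ConvexOn ℝ (Set.Icc (t i) (t j)) (hingeSum t N μ) := by
  refine ⟨convex_Icc _ _, fun x hx y hy a b ha hb hab => ?_⟩
  simp only [hingeSum_apply, smul_eq_mul, Finset.mul_sum, ← Finset.sum_add_distrib]
  refine Finset.sum_le_sum fun l hl => ?_
  obtain ⟨hx1, hx2⟩ := hx
  obtain ⟨hy1, hy2⟩ := hy
  have hz : a * t i + b * t i ≤ a * x + b * y :=
    add_le_add (mul_le_mul_of_nonneg_left hx1 ha) (mul_le_mul_of_nonneg_left hy1 hb)
  have hz' : a * x + b * y ≤ a * t j + b * t j :=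
    add_le_add (mul_le_mul_of_nonneg_left hx2 ha) (mul_le_mul_of_nonneg_left hy2 hb)
  rw [← add_mul, hab, one_mul] at hz hz'
  rcases le_or_gt l i with h | h
  · have := ht.monotone h
    rw [max_eq_right (by linarith), max_eq_right (by linarith), max_eq_right (by linarith)]
    simp
  rcases le_or_gt j l with h' | h'
  · have := ht.monotone h'
    rw [max_eq_left (by linarith), max_eq_left (by linarith), max_eq_left (by linarith)]
    apply le_of_eq
    linear_combination (- t l * μ l) * hab
  · have h1 : max (t l - (a * x + b * y)) 0 ≤ a * max (t l - x) 0 + b * max (t l - y) 0 := by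
      refine max_le ?_ (by positivity)
      have e1 := mul_le_mul_of_nonneg_left (le_max_left (t l - x) 0) ha
      have e2 := mul_le_mul_of_nonneg_left (le_max_left (t l - y) 0) hb
      have e3 : t l - (a * x + b * y) = a * (t l - x) + b * (t l - y) := by
        linear_combination (- t l) * hab
      linarith
    have := mul_le_mul_of_nonneg_right h1 (hμ l (by simpa [Nat.lt_succ_iff] using hl) h h')
    linarith

/-- A continuous convex function on an interval is nonpositive on a (possibly degenerate)
subinterval and nonnegative on both sides of it. -/
theorem ConvexOn.exists_sign_intervals {H : ℝ → ℝ} {a b : ℝ} (hab : a ≤ b)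
    (hH : ConvexOn ℝ (Set.Icc a b) H) (hc : Continuous H) :
    ∃ α β, a ≤ α ∧ α ≤ β ∧ β ≤ b ∧ (∀ x, a ≤ x → x < α → 0 ≤ H x) ∧
      (∀ x, α < x → x < β → H x ≤ 0) ∧ (∀ x, β < x → x ≤ b → 0 ≤ H x) ∧
      (H a = 0 → α = a) ∧ (H b = 0 → β = b) := by
  set Z := {x ∈ Set.Icc a b | H x ≤ 0} with hZ
  by_cases hne : Z.Nonempty
  · have hZc : IsCompact Z := isCompact_Icc.inter_right (isClosed_le hc continuous_const)
    have hα := hZc.sInf_mem hne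
    have hβ := hZc.sSup_mem hne
    have hconv : Convex ℝ Z := hH.convex_le 0
    refine ⟨sInf Z, sSup Z, hα.1.1, le_csSup hZc.bddAbove hα, hβ.1.2, ?_, ?_, ?_, ?_, ?_⟩
    · intro x h1 h2
      by_contra! h
      exact absurd (csInf_le hZc.bddBelow
        (show x ∈ Z from ⟨⟨h1, h2.le.trans hα.1.2⟩, h.le⟩)) (not_le.2 h2)
    · intro x h1 h2
      exact (hconv.ordConnected.out hα hβ ⟨h1.le, h2.le⟩).2
    · intro x h1 h2
      by_contra! h
      exact absurd (le_csSup hZc.bddAbove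
        (show x ∈ Z from ⟨⟨hβ.1.1.trans h1.le, h2⟩, h.le⟩)) (not_le.2 h1)
    · intro h
      exact le_antisymm (csInf_le hZc.bddBelow (show a ∈ Z from ⟨⟨le_rfl, hab⟩, h.le⟩)) hα.1.1
    · intro h
      exact le_antisymm hβ.1.2 (le_csSup hZc.bddAbove (show b ∈ Z from ⟨⟨hab, le_rfl⟩, h.le⟩))
  · have hpos : ∀ x, a ≤ x → x ≤ b → 0 < H x := by
      intro x h1 h2
      by_contra! h
      exact hne ⟨x, ⟨h1, h2⟩, h⟩
    refine ⟨a, a, le_rfl, le_rfl, hab, ?_, ?_, ?_, ?_, ?_⟩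
    · intro x h1 h2; linarith
    · intro x h1 h2; linarith
    · intro x h1 h2; exact (hpos x h1.le h2).le
    · intro h; rfl
    · intro h; exact absurd h (hpos b hab le_rfl).ne'

/-- The signs of `H` on the gaps of `A` fit together into one cell for each inner vertex, on which
`H` is nonnegative for vertices in `A` and nonpositive for the others. -/
theorem exists_sign_cells {t : ℕ → ℝ} (ht : StrictMono t) {A : Finset ℕ} {m : ℕ} {H : ℝ → ℝ}
    (h0 : 0 ∈ A) (hN : m + 2 ∈ A)
    (hgap : ∀ i j, Consecutive A i j → j ≤ m + 2 → ∃ α β, t i ≤ α ∧ α ≤ β ∧ β ≤ t j ∧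
      (∀ x, t i ≤ x → x < α → 0 ≤ H x) ∧ (∀ x, α < x → x < β → H x ≤ 0) ∧
      (∀ x, β < x → x ≤ t j → 0 ≤ H x) ∧ (i = 0 → α = t i) ∧ (j = m + 2 → β = t j))
    (hnn : ∀ k ≤ m + 1, k ∈ A → k + 1 ∈ A → ∀ x, t k ≤ x → x ≤ t (k + 1) → 0 ≤ H x) :
    ∃ τ : ℕ → ℝ, τ 0 = t 0 ∧ τ (m + 1) = t (m + 2) ∧ (∀ k ≤ m, τ k ≤ τ (k + 1)) ∧
      (∀ k ≤ m, k + 1 ∈ A → ∀ x, τ k < x → x < τ (k + 1) → 0 ≤ H x) ∧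
      (∀ k ≤ m, k + 1 ∉ A → ∀ x, τ k < x → x < τ (k + 1) → H x ≤ 0) := by
  have hgap' : ∀ i j, ∃ α β, Consecutive A i j → j ≤ m + 2 → (t i ≤ α ∧ α ≤ β ∧ β ≤ t j ∧
      (∀ x, t i ≤ x → x < α → 0 ≤ H x) ∧ (∀ x, α < x → x < β → H x ≤ 0) ∧
      (∀ x, β < x → x ≤ t j → 0 ≤ H x) ∧ (i = 0 → α = t i) ∧ (j = m + 2 → β = t j)) := by
    intro i j
    by_cases hc : Consecutive A i j ∧ j ≤ m + 2
    · obtain ⟨α, β, h⟩ := hgap i j hc.1 hc.2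
      exact ⟨α, β, fun _ _ => h⟩
    · exact ⟨0, 0, fun h1 h2 => absurd ⟨h1, h2⟩ hc⟩
  choose α β hαβ using hgap'
  have hIJ : ∀ k, ∃ i j, k ≤ m + 1 → Consecutive A i j ∧ i ≤ k ∧ k < j := by
    intro k
    by_cases hk : k ≤ m + 1
    · obtain ⟨i, j, h⟩ := exists_consecutive h0 hN (Nat.lt_succ_of_le hk)
      exact ⟨i, j, fun _ => h⟩
    · exact ⟨0, 0, fun h => absurd h hk⟩
  choose I J hIJ using hIJ
  have hJ : ∀ k ≤ m + 1, J k ≤ m + 2 := by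
    intro k hk
    obtain ⟨hc, h1, -⟩ := hIJ k hk
    rcases hc.le_or_le hN with h | h
    · omega
    · exact h
  let a : ℕ → ℝ := fun k => α (I k) (J k)
  let b : ℕ → ℝ := fun k => β (I k) (J k)
  have hab : ∀ k ≤ m + 1, t (I k) ≤ a k ∧ a k ≤ b k ∧ b k ≤ t (J k) ∧
      (∀ x, t (I k) ≤ x → x < a k → 0 ≤ H x) ∧ (∀ x, a k < x → x < b k → H x ≤ 0) ∧
      (∀ x, b k < x → x ≤ t (J k) → 0 ≤ H x) ∧ (I k = 0 → a k = t (I k)) ∧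
      (J k = m + 2 → b k = t (J k)) := fun k hk => hαβ _ _ (hIJ k hk).1 (hJ k hk)
  have hsame : ∀ k ≤ m, k ∉ A → k + 1 ∉ A → I k = I (k + 1) ∧ J k = J (k + 1) := by
    intro k hk hA hB
    obtain ⟨hc, h1, h2⟩ := hIJ k (by omega)
    obtain ⟨hc', h1', h2'⟩ := hIJ (k + 1) (by omega)
    have e1 : I (k + 1) ≠ k + 1 := fun h => hB (h ▸ hc'.1)
    have e2 : J k ≠ k + 1 := fun h => hB (h ▸ hc.2.1)
    constructor
    · rcases hc.le_or_le hc'.1 with h | h <;> rcases hc'.le_or_le hc.1 with h' | h' <;> omega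
    · rcases hc.le_or_le hc'.2.1 with h | h <;> rcases hc'.le_or_le hc.2.1 with h' | h' <;> omega
  have hJk : ∀ k ≤ m + 1, k + 1 ∈ A → J k = k + 1 := by
    intro k hk hA
    obtain ⟨hc, h1, h2⟩ := hIJ k hk
    rcases hc.le_or_le hA with h | h <;> omega
  have hIk : ∀ k ≤ m, k ∈ A → k + 1 ∉ A → I (k + 1) = k := by
    intro k hk hA hB
    obtain ⟨hc, h1, h2⟩ := hIJ (k + 1) (by omega)
    have e1 : I (k + 1) ≠ k + 1 := fun h => hB (h ▸ hc.1)
    rcases hc.le_or_le hA with h | h <;> omega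
  -- `τ k` separates the cells of the vertices `k` and `k + 1`.
  let τ : ℕ → ℝ := fun k =>
    if k + 1 ∈ A then (if k ∈ A then (if k = 0 then t 0 else t (k + 1)) else b k) else a (k + 1)
  have hout : ∀ k ≤ m, k + 1 ∉ A →
      τ k = a (k + 1) ∧ (τ (k + 1) = a (k + 1) ∨ τ (k + 1) = b (k + 1)) := by
    intro k hk hA
    refine ⟨by simp [τ, hA], ?_⟩
    by_cases hB : k + 1 + 1 ∈ A
    · right; simp [τ, hA, hB]
    · left
      have hk' : k + 1 ≤ m := by
        by_contra h
        obtain rfl : k = m := by omega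
        exact hB hN
      obtain ⟨e1, e2⟩ := hsame (k + 1) hk' hA hB
      simp only [τ, hB, if_false, a, e1, e2]
  have hin : ∀ k ≤ m, k + 1 ∈ A → τ k ≤ t (k + 1) ∧ t (k + 1) ≤ τ (k + 1) ∧
      (∀ x, τ k < x → x ≤ t (k + 1) → 0 ≤ H x) ∧
      (∀ x, t (k + 1) ≤ x → x < τ (k + 1) → 0 ≤ H x) := by
    intro k hk hA
    have hlt : t k ≤ t (k + 1) := ht.monotone (by omega)
    have hlt' : t (k + 1) ≤ t (k + 2) := ht.monotone (by omega)
    have hleft : τ k ≤ t (k + 1) ∧ (∀ x, τ k < x → x ≤ t (k + 1) → 0 ≤ H x) := by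
      by_cases hB : k ∈ A
      · have hτ : τ k = t k ∨ τ k = t (k + 1) := by
          by_cases hk0 : k = 0
          · left; subst hk0; simp only [τ, hA, hB, if_true]
          · right; simp only [τ, hA, hB, hk0, if_true, if_false]
        have hτ' : t k ≤ τ k := by rcases hτ with h | h <;> linarith
        exact ⟨by rcases hτ with h | h <;> linarith,
          fun x h1 h2 => hnn k (by omega) hB hA x (hτ'.trans h1.le) h2⟩
      · have hτ : τ k = b k := by simp only [τ, hA, hB, if_true, if_false]
        obtain ⟨-, -, g3, -, -, g6, -, -⟩ := hab k (by omega)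
        rw [hJk k (by omega) hA] at g3 g6
        rw [hτ]
        exact ⟨g3, g6⟩
    have hright : t (k + 1) ≤ τ (k + 1) ∧ (∀ x, t (k + 1) ≤ x → x < τ (k + 1) → 0 ≤ H x) := by
      by_cases hB : k + 1 + 1 ∈ A
      · have hτ : τ (k + 1) = t (k + 2) := by simp [τ, hA, hB]
        rw [hτ]
        exact ⟨hlt', fun x h1 h2 => hnn (k + 1) (by omega) hA hB x h1 h2.le⟩
      · have hτ : τ (k + 1) = a (k + 2) := by simp [τ, hB]
        have hk' : k + 1 ≤ m := by
          by_contra h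
          obtain rfl : k = m := by omega
          exact hB hN
        obtain ⟨g1, -, -, g4, -⟩ := hab (k + 2) (by omega)
        rw [hIk (k + 1) hk' hA hB] at g1 g4
        rw [hτ]
        exact ⟨g1, g4⟩
    exact ⟨hleft.1, hright.1, hleft.2, hright.2⟩
  refine ⟨τ, ?_, ?_, ?_, ?_, ?_⟩
  · by_cases hA : 0 + 1 ∈ A
    · simp only [τ, hA, h0, if_true]
    · have hI := hIk 0 (by omega) h0 hA
      have : τ 0 = a (0 + 1) := by simp only [τ, hA, if_false]
      rw [this, (hab (0 + 1) (by omega)).2.2.2.2.2.2.1 hI, hI]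
  · have hN' : m + 1 + 1 ∈ A := hN
    by_cases hA : m + 1 ∈ A
    · simp [τ, hN', hA]
    · have hJ' := hJk (m + 1) le_rfl hN'
      have : τ (m + 1) = b (m + 1) := by simp only [τ, hN', hA, if_true, if_false]
      rw [this, (hab (m + 1) le_rfl).2.2.2.2.2.2.2 hJ', hJ']
  · intro k hk
    by_cases hA : k + 1 ∈ A
    · exact (hin k hk hA).1.trans (hin k hk hA).2.1
    · have := (hab (k + 1) (by omega)).2.1
      rcases hout k hk hA with ⟨h1, h2 | h2⟩ <;> rw [h1, h2]
      exact this
  · intro k hk hA x h1 h2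
    obtain ⟨-, -, g3, g4⟩ := hin k hk hA
    rcases le_total x (t (k + 1)) with h | h
    · exact g3 x h1 h
    · exact g4 x h h2
  · intro k hk hA x h1 h2
    have := (hab (k + 1) (by omega)).2.2.2.2.1 x
    rcases hout k hk hA with ⟨e1, e2 | e2⟩
    · rw [e1] at h1; rw [e2] at h2; linarith
    · rw [e1] at h1; rw [e2] at h2; exact this h1 h2

/-! ### Realizing sign vectors with few changes -/

theorem nonneg_of_continuous_of_finite {g : ℝ → ℝ} (hg : Continuous g) {a b : ℝ} {F : Set ℝ}
    (hF : F.Finite) (h : ∀ x, a < x → x < b → x ∉ F → 0 ≤ g x) {x : ℝ} (ha : a < x)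
    (hb : x < b) : 0 ≤ g x := by
  by_contra! hx
  have hopen : IsOpen (Set.Ioo a b ∩ {x | g x < 0}) :=
    isOpen_Ioo.inter (isOpen_lt hg continuous_const)
  obtain ⟨y, hy, hyF⟩ := (hF.countable.dense_compl ℝ).inter_open_nonempty _ hopen ⟨x, ⟨ha, hb⟩, hx⟩
  exact absurd (h y hy.1.1 hy.1.2 hyF) (not_le.2 hy.2)

/-- Weights that are orthogonal to affine functions, nonnegative outside `A`, and whose kernel is
nonnegative at `A`, pair positively with some polynomial of small degree: the kernel is convex on
every gap of `A`, so it changes sign at most as often as membership in `A` changes, and the second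
derivative of the polynomial is made to change sign with it. -/
theorem exists_polynomial_gridPairing_pos {t : ℕ → ℝ} (ht : StrictMono t) {A : Finset ℕ} {m : ℕ}
    (h0 : 0 ∈ A) (hN : m + 2 ∈ A) {μ : ℕ → ℝ}
    (hone : gridPairing (m + 2) (fun _ => 1) μ = 0) (hid : gridPairing (m + 2) t μ = 0)
    (hμ : ∀ k ≤ m + 2, k ∉ A → 0 ≤ μ k)
    (hA : ∀ k ∈ A, 0 ≤ hingeSum t (m + 2) μ (t k))
    (hne : ∃ k ≤ m + 2, μ k ≠ 0) :
    ∃ p : Polynomial ℝ, p.natDegree ≤ numChanges A m + 2 ∧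
      0 < gridPairing (m + 2) (fun l => p.eval (t l)) μ := by
  set H := hingeSum t (m + 2) μ with hH
  have hc : Continuous H := continuous_hingeSum _ _ _
  have hfirst : H (t 0) = 0 := hingeSum_first ht hone hid
  have hlast : H (t (m + 2)) = 0 := hingeSum_last ht _ _
  obtain ⟨τ, hτ0, hτN, hτ, hpos, hneg⟩ := exists_sign_cells (H := H) ht h0 hN
    (fun i j hij hj => by
      have hconv : ConvexOn ℝ (Set.Icc (t i) (t j)) H :=
        convexOn_hingeSum ht fun k hk h1 h2 => hμ k hk (hij.2.2.2 k h1 h2)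
      obtain ⟨α, β, g1, g2, g3, g4, g5, g6, g7, g8⟩ :=
        hconv.exists_sign_intervals (ht.monotone hij.2.2.1.le) hc
      refine ⟨α, β, g1, g2, g3, g4, g5, g6, ?_, ?_⟩
      · rintro rfl; exact g7 hfirst
      · rintro rfl; exact g8 hlast)
    (fun k _ hk hk' x h1 h2 => hingeSum_nonneg_between ht (hA k hk) (hA _ hk') h1 h2)
  obtain ⟨r, hr, hdeg, -, hrH⟩ := exists_polynomial_mul_nonneg H (fun k => k + 1 ∈ A) τ m hτ
    hpos hneg
  obtain ⟨q, hq, hqdeg⟩ := exists_derivative_eq r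
  obtain ⟨p, hp, hpdeg⟩ := exists_derivative_eq q
  refine ⟨p, ?_, ?_⟩
  · have : r.natDegree ≤ numChanges A m := hdeg
    omega
  rw [gridPairing_eval_eq_integral ht hone hid, hp, hq]
  have hcont : Continuous fun x => r.eval x * H x := r.continuous.mul hc
  have hnn : ∀ x, t 0 < x → x < t (m + 2) → 0 ≤ r.eval x * H x := by
    intro x h1 h2
    refine nonneg_of_continuous_of_finite hcont
      ((Set.finite_Iic m).image τ) (fun y hy hy' hyF => ?_) h1 h2
    exact hrH y (hτ0 ▸ hy) (hτN ▸ hy') fun k hk h => hyF ⟨k, hk, h.symm⟩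
  -- Near the last grid point with nonzero weight, the kernel is a nonzero affine function.
  obtain ⟨K, hK, hmax⟩ : ∃ K, (K ≤ m + 2 ∧ μ K ≠ 0) ∧ ∀ l ≤ m + 2, K < l → μ l = 0 := by
    have hn : ((Finset.range (m + 3)).filter fun k => μ k ≠ 0).Nonempty := by
      obtain ⟨k, hk, hk'⟩ := hne
      exact ⟨k, by simp [hk']; omega⟩
    refine ⟨Finset.max' _ hn, ?_, fun l hl hlK => ?_⟩
    · have := Finset.max'_mem _ hn
      simp only [Finset.mem_filter, Finset.mem_range] at this
      exact ⟨by omega, this.2⟩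
    · by_contra h
      exact absurd (Finset.le_max' ((Finset.range (m + 3)).filter fun k => μ k ≠ 0) l
        (by simp [h]; omega)) (not_le.2 hlK)
  have hK0 : K ≠ 0 := by
    rintro rfl
    rw [gridPairing_apply, Finset.sum_eq_single 0] at hone
    · exact hK.2 (by simpa using hone)
    · intro l hl hl0
      rw [hmax l (by simpa [Nat.lt_succ_iff] using hl) (by omega), mul_zero]
    · intro h; simp at h
  obtain ⟨K, rfl⟩ := Nat.exists_eq_succ_of_ne_zero hK0
  have hlt : t K < t (K + 1) := ht (by omega)
  have hHK : ∀ x, t K ≤ x → x < t (K + 1) → H x ≠ 0 := by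
    intro x h1 h2
    rw [hH, hingeSum_apply, Finset.sum_eq_single (K + 1)]
    · rw [max_eq_left (by linarith)]
      exact mul_ne_zero (by linarith) hK.2
    · intro l hl hlK
      rcases lt_or_gt_of_ne hlK with h | h
      · rw [max_eq_right, zero_mul]
        have := ht.monotone (show l ≤ K by omega)
        linarith
      · rw [hmax l (by simpa [Nat.lt_succ_iff] using hl) h, mul_zero]
    · intro h
      exact absurd (Finset.mem_range.2 (by omega)) h
  obtain ⟨x, hx, hxr⟩ : ∃ x ∈ Set.Ioo (t K) (t (K + 1)), x ∉ (r.roots.toFinset : Set ℝ) :=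
    ((Set.Ioo_infinite hlt).sdiff (Finset.finite_toSet _)).nonempty
  have hx0 : t 0 < x := (ht.monotone (Nat.zero_le K)).trans_lt hx.1
  have hxN : x < t (m + 2) := hx.2.trans_le (ht.monotone hK.1)
  have hgoal := intervalIntegral.integral_pos (f := fun x => r.eval x * H x)
    (ht (by omega : 0 < m + 2)) hcont.continuousOn
    (fun y hy => by
      rcases hy.2.eq_or_lt with h | h
      · simp [h, hlast]
      · exact hnn y hy.1 h)
    ⟨x, ⟨hx0.le, hxN.le⟩, lt_of_le_of_ne (hnn x hx0 hxN)
      (mul_ne_zero (fun h => hxr (by simp [hr, h])) (hHK x hx.1.le hx.2)).symm⟩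
  simpa only [mul_comm] using hgoal

theorem chordExcess_hinge_nonneg {t : ℕ → ℝ} (ht : StrictMono t) {A : Finset ℕ} {i j a : ℕ}
    (hij : Consecutive A i j) (ha : a ∈ A) (k : ℕ) :
    0 ≤ chordExcess t (fun l => max (t l - t a) 0) i j k := by
  have hlt : 0 < t j - t i := sub_pos.2 (ht hij.2.2.1)
  rcases hij.le_or_le ha with h | h
  · have := ht.monotone h
    have e := mul_le_mul_of_nonneg_left (le_max_left (t k - t a) 0) hlt.le
    simp only [chordExcess]
    rw [max_eq_left (show 0 ≤ t i - t a by linarith),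
      max_eq_left (show 0 ≤ t j - t a by linarith)]
    linarith
  · have := ht.monotone h
    simp only [chordExcess]
    rw [max_eq_right (show t i - t a ≤ 0 by linarith),
      max_eq_right (show t j - t a ≤ 0 by linarith)]
    have := mul_nonneg hlt.le (le_max_right (t k - t a) 0)
    linarith

/-- Every vertex set is the lower hull of some heights: lift the points of `A` to the parabola and
the others far above it. -/
theorem exists_hasLowerHull {t : ℕ → ℝ} (ht : StrictMono t) {A : Finset ℕ} {N : ℕ}
    (hA : ∀ k ∈ A, k ≤ N) : ∃ w, HasLowerHull t N A w := by
  refine ⟨fun k => t k ^ 2 + if k ∈ A then 0 else (t N - t 0) ^ 2 + 1,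
    fun i j hij k hk hki hkj => ?_⟩
  have hlt : 0 < t j - t i := sub_pos.2 (ht hij.2.2.1)
  have hE : ∀ c, chordExcess t (fun k => t k ^ 2 + if k ∈ A then 0 else c) i j k =
      (t j - t i) * ((t k - t i) * (t k - t j) + if k ∈ A then 0 else c) := by
    intro c
    simp only [chordExcess, hij.1, hij.2.1, if_true]
    ring
  rw [hE]
  refine mul_pos hlt ?_
  by_cases hkA : k ∈ A
  · rw [if_pos hkA, add_zero]
    rcases hij.le_or_le hkA with h | h
    · have h1 := ht (lt_of_le_of_ne h hki)
      exact mul_pos_of_neg_of_neg (by linarith) (by linarith)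
    · have h1 := ht (lt_of_le_of_ne h hkj.symm)
      exact mul_pos (by linarith) (by linarith)
  · rw [if_neg hkA]
    have hb : ∀ l ≤ N, ∀ l' ≤ N, |t l - t l'| ≤ t N - t 0 := by
      intro l hl l' hl'
      have a1 := ht.monotone hl
      have a2 := ht.monotone hl'
      have a3 := ht.monotone (Nat.zero_le l)
      have a4 := ht.monotone (Nat.zero_le l')
      exact abs_le.2 ⟨by linarith, by linarith⟩
    have h1 := mul_le_mul (hb k hk i (hA i hij.1)) (hb k hk j (hA j hij.2.1)) (abs_nonneg _)
      ((abs_nonneg _).trans (hb k hk i (hA i hij.1)))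
    rw [← abs_mul] at h1
    have h2 := neg_abs_le ((t k - t i) * (t k - t j))
    nlinarith

/-- If membership in `A` changes at most `d - 2` times, then `A` is the lower hull of the heights
given by some linear functional on the moment curve. Otherwise, by separation, a convex
combination of the chord inequalities vanishes on all polynomials of degree `d`, contradicting
`exists_polynomial_gridPairing_pos`. -/
theorem exists_linear_hasLowerHull {t : ℕ → ℝ} (ht : StrictMono t) {A : Finset ℕ} {m d : ℕ}
    (h0 : 0 ∈ A) (hN : m + 2 ∈ A) (hA : ∀ k ∈ A, k ≤ m + 2) (hd : numChanges A m + 2 ≤ d) :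
    ∃ f : EuclideanSpace ℝ (Fin d) →ₗ[ℝ] ℝ,
      HasLowerHull t (m + 2) A fun k => f (momentPoint d (t k)) := by
  let S : Set (ℕ → ℝ) := {g | ∃ i j k, Consecutive A i j ∧ k ≤ m + 2 ∧ k ≠ i ∧ k ≠ j ∧
    g = chordWeights t i j k}
  have hSfin : S.Finite := by
    refine (((Set.finite_Iic (m + 2)).prod ((Set.finite_Iic (m + 2)).prod
      (Set.finite_Iic (m + 2)))).image fun x => chordWeights t x.1 x.2.1 x.2.2).subset ?_
    rintro g ⟨i, j, k, hij, hk, -, -, rfl⟩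
    exact ⟨(i, j, k), ⟨hA i hij.1, hA j hij.2.1, hk⟩, rfl⟩
  have hS : ∀ w : ℕ → ℝ, ∀ g ∈ S, ∃ i j k, Consecutive A i j ∧ k ≤ m + 2 ∧ k ≠ i ∧ k ≠ j ∧
      gridPairing (m + 2) w g = chordExcess t w i j k := by
    rintro w g ⟨i, j, k, hij, hk, hki, hkj, rfl⟩
    exact ⟨i, j, k, hij, hk, hki, hkj,
      gridPairing_chordWeights t w (hA i hij.1) (hA j hij.2.1) hk⟩
  have hnn : ∀ w : ℕ → ℝ, (∀ i j k, Consecutive A i j → k ≤ m + 2 → k ≠ i → k ≠ j →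
      0 ≤ chordExcess t w i j k) → ∀ μ ∈ convexHull ℝ S, 0 ≤ gridPairing (m + 2) w μ := by
    intro w hw
    refine convexHull_min (fun g hg => ?_)
      (convex_halfSpace_ge (gridPairing (m + 2) w).isLinear 0)
    obtain ⟨i, j, k, hij, hk, hki, hkj, h⟩ := hS w g hg
    exact (hw i j k hij hk hki hkj).trans_eq h.symm
  let v : ℕ → EuclideanSpace ℝ (Fin d) := fun l => momentPoint d (t l)
  let U : (ℕ → ℝ) →ₗ[ℝ] EuclideanSpace ℝ (Fin d) :=
    ∑ l ∈ Finset.range (m + 2 + 1), (LinearMap.proj l : (ℕ → ℝ) →ₗ[ℝ] ℝ).smulRight (v l)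
  have hU : ∀ μ, U μ = ∑ l ∈ Finset.range (m + 2 + 1), μ l • v l := by
    intro μ; simp [U]
  have hfU : ∀ (f : EuclideanSpace ℝ (Fin d) →ₗ[ℝ] ℝ) μ,
      f (U μ) = gridPairing (m + 2) (fun l => f (v l)) μ := by
    intro f μ
    rw [hU, gridPairing_apply, map_sum]
    exact Finset.sum_congr rfl fun l _ => by rw [map_smul, smul_eq_mul, mul_comm]
  have hclosed : IsClosed (convexHull ℝ (U '' S)) :=
    ((hSfin.image U).isCompact_convexHull (𝕜 := ℝ)).isClosed
  by_cases hmem : (0 : EuclideanSpace ℝ (Fin d)) ∈ convexHull ℝ (U '' S)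
  · exfalso
    rw [← LinearMap.image_convexHull] at hmem
    obtain ⟨μ, hμS, hμ0⟩ := hmem
    have hone : gridPairing (m + 2) (fun _ => 1) μ = 0 := by
      have h1 := hnn (fun _ => 1) (fun i j k _ _ _ _ => by simp [chordExcess]) μ hμS
      have h2 := hnn (fun _ => -1) (fun i j k _ _ _ _ => by simp [chordExcess]) μ hμS
      simp only [gridPairing_apply, one_mul, neg_mul, Finset.sum_neg_distrib] at h1 h2 ⊢
      linarith
    have hpow : ∀ i < d, gridPairing (m + 2) (fun l => t l ^ (i + 1)) μ = 0 := by
      intro i hi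
      have := hfU (EuclideanSpace.proj (⟨i, hi⟩ : Fin d)).toLinearMap μ
      rw [hμ0, map_zero] at this
      rw [this]
      rfl
    have hid : gridPairing (m + 2) t μ = 0 := by
      simpa using hpow 0 (by omega)
    have hpoly : ∀ p : Polynomial ℝ, p.natDegree ≤ d →
        gridPairing (m + 2) (fun l => p.eval (t l)) μ = 0 := by
      intro p hp
      have : gridPairing (m + 2) (fun l => p.eval (t l)) μ =
          ∑ i ∈ Finset.range (d + 1),
            p.coeff i * gridPairing (m + 2) (fun l => t l ^ i) μ := by
        simp only [gridPairing_apply, Finset.mul_sum]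
        rw [Finset.sum_comm]
        refine Finset.sum_congr rfl fun l _ => ?_
        rw [p.eval_eq_sum_range' (Nat.lt_succ_of_le hp), Finset.sum_mul]
        exact Finset.sum_congr rfl fun i _ => by ring
      rw [this]
      refine Finset.sum_eq_zero fun i hi => ?_
      rcases i with _ | i
      · simp only [pow_zero]
        rw [hone, mul_zero]
      · rw [hpow i (by simpa using hi), mul_zero]
    have hμnn : ∀ k ≤ m + 2, k ∉ A → 0 ≤ μ k := by
      intro k hk hkA
      have := hnn (Pi.single k 1) (fun i j l hij hl _ _ => by
        have h1 : i ≠ k := fun h => hkA (h ▸ hij.1)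
        have h2 : j ≠ k := fun h => hkA (h ▸ hij.2.1)
        have hlt : 0 ≤ t j - t i := sub_nonneg.2 (ht.monotone hij.2.2.1.le)
        simp only [chordExcess, Pi.single_eq_of_ne h1, Pi.single_eq_of_ne h2, mul_zero, sub_zero]
        refine mul_nonneg hlt ?_
        by_cases h : l = k
        · subst h; simp
        · simp [h]) μ hμS
      rw [gridPairing_apply, Finset.sum_eq_single k (fun b _ hb => by simp [hb])
        (fun h => absurd (Finset.mem_range.2 (by omega)) h)] at this
      simpa using this
    obtain ⟨w, hw⟩ := exists_hasLowerHull ht hA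
    have hwpos : 0 < gridPairing (m + 2) w μ := by
      refine convexHull_min (s := S) (t := {μ | 0 < gridPairing (m + 2) w μ}) (fun g hg => ?_)
        (convex_halfSpace_gt (gridPairing (m + 2) w).isLinear 0) hμS
      obtain ⟨i, j, k, hij, hk, hki, hkj, h⟩ := hS w g hg
      exact (hw i j hij k hk hki hkj).trans_eq h.symm
    have hne : ∃ k ≤ m + 2, μ k ≠ 0 := by
      by_contra! h
      rw [gridPairing_apply, Finset.sum_eq_zero fun l hl => by
        rw [h l (by simpa [Nat.lt_succ_iff] using hl), mul_zero]] at hwpos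
      exact lt_irrefl _ hwpos
    obtain ⟨p, hp, hpos⟩ := exists_polynomial_gridPairing_pos ht h0 hN hone hid hμnn
      (fun k hk => hnn _ (fun i j l hij _ _ _ => chordExcess_hinge_nonneg ht hij hk l) μ hμS) hne
    exact hpos.ne' (hpoly p (hp.trans hd))
  · obtain ⟨f, u, hf0, hf⟩ :=
      geometric_hahn_banach_point_closed (convex_convexHull ℝ (U '' S)) hclosed hmem
    refine ⟨f.toLinearMap, fun i j hij k hk hki hkj => ?_⟩
    rw [map_zero] at hf0
    have h := hf (U (chordWeights t i j k))
      (subset_convexHull ℝ _ ⟨_, ⟨i, j, k, hij, hk, hki, hkj, rfl⟩, rfl⟩)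
    have h' := hfU f.toLinearMap (chordWeights t i j k)
    rw [gridPairing_chordWeights t _ (hA i hij.1) (hA j hij.2.1) hk] at h'
    rw [← h']
    exact hf0.trans h

/-! ### Faces of polytopes -/

section

variable {E : Type*} [NormedAddCommGroup E] [NormedSpace ℝ E]

/-- A face of a polytope is the convex hull of the vertices it contains (by Krein–Milman). -/
theorem IsPolytopeFace.eq_convexHull {V F : Set E} (hV : V.Finite)
    (hF : IsPolytopeFace (convexHull ℝ V) F) : F = convexHull ℝ (V ∩ F) := by
  have hconv : Convex ℝ F := hF.2.convex (convex_convexHull ℝ V)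
  refine Set.Subset.antisymm ?_ (convexHull_min Set.inter_subset_right hconv)
  have hcomp : IsCompact F := hF.2.isCompact (hV.isCompact_convexHull (𝕜 := ℝ))
  have hclosed : IsClosed (convexHull ℝ (V ∩ F)) :=
    ((hV.subset Set.inter_subset_left).isCompact_convexHull (𝕜 := ℝ)).isClosed
  have hext : F.extremePoints ℝ ⊆ V ∩ F := fun x hx =>
    ⟨extremePoints_convexHull_subset (hF.2.isExtreme.extremePoints_subset_extremePoints hx), hx.1⟩
  calc F = closure (convexHull ℝ (F.extremePoints ℝ)) :=
        (closure_convexHull_extremePoints hcomp hconv).symm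
    _ ⊆ closure (convexHull ℝ (V ∩ F)) := closure_mono (convexHull_mono hext)
    _ = _ := hclosed.closure_eq

theorem finite_setOf_isPolytopeFace {V : Set E} (hV : V.Finite) :
    {F | IsPolytopeFace (convexHull ℝ V) F}.Finite := by
  refine (hV.finite_subsets.image (convexHull ℝ)).subset fun F hF => ?_
  exact ⟨V ∩ F, Set.inter_subset_left, (hF.eq_convexHull hV).symm⟩

/-- A polytope has finitely many faces and intersecting faces meet in a face, so there is a smallest
face around any nonempty subset. -/
theorem exists_isLeast_face {V X : Set E} (hV : V.Finite) (hX : X.Nonempty)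
    (hXV : X ⊆ convexHull ℝ V) :
    ∃ F, IsLeast {G | IsPolytopeFace (convexHull ℝ V) G ∧ X ⊆ G} F := by
  have hfin : {G | IsPolytopeFace (convexHull ℝ V) G ∧ X ⊆ G}.Finite :=
    (finite_setOf_isPolytopeFace hV).subset fun G hG => hG.1
  have hsub : X ⊆ ⋂₀ (hfin.toFinset : Set (Set E)) :=
    Set.subset_sInter fun G hG => (hfin.mem_toFinset.1 hG).2
  refine ⟨⋂₀ (hfin.toFinset : Set (Set E)), ⟨⟨hX.mono hsub, ?_⟩, hsub⟩, fun G hG =>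
    Set.sInter_subset_of_mem (Finset.mem_coe.2 (hfin.mem_toFinset.2 hG))⟩
  refine IsExposed.sInter
    ⟨convexHull ℝ V, hfin.mem_toFinset.2 ⟨⟨hX.mono hXV, IsExposed.refl _⟩, hXV⟩⟩
    fun G hG => (hfin.mem_toFinset.1 hG).1.2

theorem IsPolytopeFace.segment_subset {P F : Set E} (hP : Convex ℝ P) (hF : IsPolytopeFace P F)
    {a b x : E} (ha : a ∈ P) (hb : b ∈ P) (hx : x ∈ F) (hxab : x ∈ openSegment ℝ a b) :
    segment ℝ a b ⊆ F := by
  have h1 := hF.2.isExtreme.left_mem_of_mem_openSegment ha hb hx hxab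
  have h2 := hF.2.isExtreme.left_mem_of_mem_openSegment hb ha hx
    (openSegment_symm ℝ a b ▸ hxab)
  exact (hF.2.convex hP).segment_subset h1 h2

theorem le_of_mem_convexHull {V : Set E} (g : E →ₗ[ℝ] ℝ) {c : ℝ} (hge : ∀ v ∈ V, c ≤ g v) {x : E}
    (hx : x ∈ convexHull ℝ V) : c ≤ g x :=
  convexHull_min (fun v hv => hge v hv) (convex_halfSpace_ge g.isLinear c) hx

theorem isPolytopeFace_setOf_eq [FiniteDimensional ℝ E] {V : Set E} (g : E →ₗ[ℝ] ℝ) {c : ℝ}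
    (hge : ∀ v ∈ V, c ≤ g v) {v₀ : E} (hv₀ : v₀ ∈ convexHull ℝ V) (hgv₀ : g v₀ = c) :
    IsPolytopeFace (convexHull ℝ V) {x | x ∈ convexHull ℝ V ∧ g x = c} := by
  refine ⟨⟨v₀, hv₀, hgv₀⟩, fun _ => ⟨-(LinearMap.toContinuousLinearMap g), ?_⟩⟩
  ext x
  constructor
  · rintro ⟨hx, hxc⟩
    refine ⟨hx, fun y hy => ?_⟩
    simpa [hxc] using le_of_mem_convexHull g hge hy
  · rintro ⟨hx, hmax⟩
    refine ⟨hx, le_antisymm ?_ (le_of_mem_convexHull g hge hx)⟩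
    simpa [hgv₀] using hmax v₀ hv₀

theorem finrank_vectorSpan_segment {x y : E} (h : x ≠ y) :
    Module.finrank ℝ (vectorSpan ℝ (segment ℝ x y)) = 1 := by
  rw [vectorSpan_segment, vsub_eq_sub, finrank_span_singleton (sub_ne_zero.2 h.symm)]

/-- On the segment between two points, a linear functional takes its extreme values at the ends. -/
theorem isLeast_isGreatest_image_segment (π : E →ₗ[ℝ] ℝ) {x y : E} (h : π x ≤ π y) :
    IsLeast (π '' segment ℝ x y) (π x) ∧ IsGreatest (π '' segment ℝ x y) (π y) := by
  have : π '' segment ℝ x y = Set.Icc (π x) (π y) := by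
    rw [← segment_eq_Icc h]
    exact image_segment ℝ π.toAffineMap x y
  rw [this]
  exact ⟨isLeast_Icc h, isGreatest_Icc h⟩

end

/-! ### The cyclic polytope over its first coordinate -/

section

variable {d : ℕ} (hd : 2 ≤ d) {t : ℕ → ℝ} (N : ℕ)

/-- The cyclic polytope on the points of the moment curve with parameters `t 0, …, t N`. -/
def momentPolytope (d : ℕ) (t : ℕ → ℝ) (N : ℕ) : Set (EuclideanSpace ℝ (Fin d)) :=
  convexHull ℝ ((fun k => momentPoint d (t k)) '' Set.Iic N)

/-- The segment between two points of the moment curve. -/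
def momentSegment (d : ℕ) (t : ℕ → ℝ) (i j : ℕ) : Set (EuclideanSpace ℝ (Fin d)) :=
  segment ℝ (momentPoint d (t i)) (momentPoint d (t j))

@[simp]
theorem firstCoord_momentPoint (x : ℝ) : firstCoord hd (momentPoint d x) = x := by
  exact pow_one x

variable {N}

theorem momentPoint_mem {k : ℕ} (hk : k ≤ N) : momentPoint d (t k) ∈ momentPolytope d t N :=
  subset_convexHull ℝ _ ⟨k, hk, rfl⟩

theorem convex_momentPolytope : Convex ℝ (momentPolytope d t N) := convex_convexHull ℝ _

theorem finite_momentPoints :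
    ((fun k => momentPoint d (t k)) '' Set.Iic N).Finite := (Set.finite_Iic N).image _

theorem momentSegment_subset {i j : ℕ} (hi : i ≤ N) (hj : j ≤ N) :
    momentSegment d t i j ⊆ momentPolytope d t N :=
  convex_momentPolytope.segment_subset (momentPoint_mem hi) (momentPoint_mem hj)

/-- Points of the moment curve are in convex position: the functional that restricts to
`(x - t i) (x - t j)` on the curve separates them. -/
theorem eq_or_eq_of_mem_momentSegment (hd : 2 ≤ d) (ht : StrictMono t) {i j k : ℕ}
    (h : momentPoint d (t k) ∈ momentSegment d t i j) : k = i ∨ k = j := by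
  obtain ⟨a, b, ha, hb, hab, h⟩ := h
  have h0 := congrArg (fun x => x ⟨0, by omega⟩) h
  have h1 := congrArg (fun x => x ⟨1, by omega⟩) h
  simp only [momentPoint, PiLp.add_apply, PiLp.smul_apply, smul_eq_mul, zero_add, pow_one] at h0 h1
  have : (t k - t i) * (t k - t j) = 0 := by
    obtain rfl : b = 1 - a := by linarith
    linear_combination (t i + t j) * h0 - h1
  rcases mul_eq_zero.1 this with h | h
  · exact Or.inl (ht.injective (sub_eq_zero.1 h))
  · exact Or.inr (ht.injective (sub_eq_zero.1 h))

theorem exists_mem_openSegment_firstCoord {a b : ℕ} {q : ℝ} (ha : t a < q)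
    (hb : q < t b) : ∃ α β : ℝ, 0 < α ∧ 0 < β ∧ α + β = 1 ∧ α * t a + β * t b = q ∧
      α • momentPoint d (t a) + β • momentPoint d (t b) ∈
        openSegment ℝ (momentPoint d (t a)) (momentPoint d (t b)) ∧
      firstCoord hd (α • momentPoint d (t a) + β • momentPoint d (t b)) = q := by
  have hlt : 0 < t b - t a := by linarith
  have h1 : 0 < (t b - q) / (t b - t a) := div_pos (by linarith) hlt
  have h2 : 0 < (q - t a) / (t b - t a) := div_pos (by linarith) hlt
  have h3 : (t b - q) / (t b - t a) + (q - t a) / (t b - t a) = 1 := by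
    rw [← add_div, div_eq_one_iff_eq hlt.ne']; ring
  have h4 : (t b - q) / (t b - t a) * t a + (q - t a) / (t b - t a) * t b = q := by
    field_simp; ring
  exact ⟨_, _, h1, h2, h3, h4, ⟨_, _, h1, h2, h3, rfl⟩, by simpa using h4⟩

theorem exists_mem_momentSegment_firstCoord {i j : ℕ} {q : ℝ} (hi : t i ≤ q)
    (hj : q ≤ t j) : ∃ x ∈ momentSegment d t i j, firstCoord hd x = q := by
  have : q ∈ firstCoord hd '' momentSegment d t i j := by
    have h := image_segment ℝ (firstCoord hd).toAffineMap (momentPoint d (t i))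
      (momentPoint d (t j))
    simp only [LinearMap.coe_toAffineMap, firstCoord_momentPoint, segment_eq_Icc (hi.trans hj)] at h
    rw [momentSegment, h]
    exact ⟨hi, hj⟩
  exact this

theorem exists_consecutive_Icc {A : Finset ℕ} (ht : StrictMono t) (h0 : 0 ∈ A)
    (hN : N ∈ A) (hpos : 0 < N) {q : ℝ} (hq : t 0 ≤ q) (hq' : q ≤ t N) :
    ∃ i j, Consecutive A i j ∧ t i ≤ q ∧ q ≤ t j := by
  obtain ⟨k, hk, h1, h2⟩ : ∃ k < N, t k ≤ q ∧ q ≤ t (k + 1) := by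
    by_contra! h
    have : ∀ k ≤ N, t k ≤ q ∧ (0 < k → t k < q) := by
      intro k
      induction k with
      | zero => intro _; exact ⟨hq, fun h => absurd h (lt_irrefl _)⟩
      | succ k ih =>
        intro hk
        have := h k (by omega) (ih (by omega)).1
        exact ⟨this.le, fun _ => this⟩
    exact absurd ((this N le_rfl).2 hpos) (not_lt.2 hq')
  obtain ⟨i, j, hc, hi, hj⟩ := exists_consecutive h0 hN hk
  exact ⟨i, j, hc, (ht.monotone hi).trans h1, h2.trans (ht.monotone hj)⟩

theorem firstCoord_mem_Icc (ht : StrictMono t) {x : EuclideanSpace ℝ (Fin d)}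
    (hx : x ∈ momentPolytope d t N) : t 0 ≤ firstCoord hd x ∧ firstCoord hd x ≤ t N := by
  constructor
  · refine le_of_mem_convexHull (firstCoord hd) ?_ hx
    rintro _ ⟨k, hk, rfl⟩
    simpa using ht.monotone (Nat.zero_le k)
  · have := le_of_mem_convexHull (-firstCoord hd) (c := -t N) ?_ hx
    · simpa using this
    · rintro _ ⟨k, hk, rfl⟩
      simpa using ht.monotone (Set.mem_Iic.1 hk)

/-- The edges of a cyclic polytope are segments between two of its vertices, because no three
points of the moment curve are collinear. -/
theorem IsPolytopeEdge.exists_eq_momentSegment (hd : 2 ≤ d) (ht : StrictMono t)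
    {F : Set (EuclideanSpace ℝ (Fin d))} (hF : IsPolytopeEdge (momentPolytope d t N) F) :
    ∃ i j, i < j ∧ j ≤ N ∧ F = momentSegment d t i j := by
  have hFeq := hF.1.eq_convexHull finite_momentPoints
  set v : ℕ → EuclideanSpace ℝ (Fin d) := fun k => momentPoint d (t k) with hv
  obtain ⟨e, he, hspan⟩ := finrank_eq_one_iff'.1 hF.2
  -- All chords of vertices in the edge have the slope of `e` in the first two coordinates.
  have hslope : ∀ i j, v i ∈ F → v j ∈ F → i ≠ j →
      (e : EuclideanSpace ℝ (Fin d)) ⟨1, by omega⟩ =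
        (t i + t j) * (e : EuclideanSpace ℝ (Fin d)) ⟨0, by omega⟩ ∧
      (e : EuclideanSpace ℝ (Fin d)) ⟨0, by omega⟩ ≠ 0 := by
    intro i j hi hj hij
    obtain ⟨c, hc⟩ := hspan ⟨v j - v i, vsub_mem_vectorSpan ℝ hj hi⟩
    have hc' := congrArg Subtype.val hc
    have h0 := congrArg (fun x : EuclideanSpace ℝ (Fin d) => x ⟨0, by omega⟩) hc'
    have h1 := congrArg (fun x : EuclideanSpace ℝ (Fin d) => x ⟨1, by omega⟩) hc'
    simp only [hv, momentPoint, Submodule.coe_smul, PiLp.sub_apply, PiLp.smul_apply, smul_eq_mul,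
      zero_add, pow_one] at h0 h1
    have hne : t j - t i ≠ 0 := sub_ne_zero.2 fun h => hij (ht.injective h).symm
    have hc0 : c ≠ 0 := by
      rintro rfl
      exact hne (by rw [← h0]; simp)
    refine ⟨mul_left_cancel₀ hc0 ?_, fun h => hne (by rw [← h0, h, mul_zero])⟩
    linear_combination h1 - (t i + t j) * h0
  have hvinj : ∀ i j, v i = v j → i = j := by
    intro i j h
    have := congrArg (firstCoord hd) h
    simp only [hv, firstCoord_momentPoint] at this
    exact ht.injective this
  have hne : ((v '' Set.Iic N) ∩ F).Nonempty := by
    rw [← convexHull_nonempty_iff (𝕜 := ℝ), ← hFeq]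
    exact hF.1.1
  obtain ⟨_, ⟨i, hi, rfl⟩, hiF⟩ := hne
  obtain ⟨j, hj, hjF, hij⟩ : ∃ j ≤ N, v j ∈ F ∧ i ≠ j := by
    by_contra! h
    have : (v '' Set.Iic N) ∩ F = {v i} := by
      ext x
      constructor
      · rintro ⟨⟨j, hj, rfl⟩, hjF⟩
        rw [h j hj hjF]; rfl
      · rintro rfl
        exact ⟨⟨i, hi, rfl⟩, hiF⟩
    have h1 := hF.2
    rw [hFeq, this, convexHull_singleton, vectorSpan_singleton] at h1
    simp at h1
  have hpair : (v '' Set.Iic N) ∩ F = {v i, v j} := by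
    ext x
    constructor
    · rintro ⟨⟨k, hk, rfl⟩, hkF⟩
      by_contra hx
      have hki : i ≠ k := by rintro rfl; exact hx (Or.inl rfl)
      obtain ⟨h1, hne⟩ := hslope i j hiF hjF hij
      obtain ⟨h2, -⟩ := hslope i k hiF hkF hki
      have := mul_right_cancel₀ hne (h1.symm.trans h2)
      have : t j = t k := by linarith
      rw [ht.injective this] at hx
      exact hx (Or.inr rfl)
    · rintro (rfl | rfl)
      · exact ⟨⟨i, hi, rfl⟩, hiF⟩
      · exact ⟨⟨j, hj, rfl⟩, hjF⟩
  rw [hpair, convexHull_pair] at hFeq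
  rcases lt_or_gt_of_ne hij with h | h
  · exact ⟨i, j, h, hj, hFeq⟩
  · exact ⟨j, i, h, hi, hFeq.trans (segment_symm ℝ _ _)⟩

/-! ### Coherent subdivisions and lower hulls -/

variable (f : EuclideanSpace ℝ (Fin d) →ₗ[ℝ] ℝ)

/-- The linear functional that exceeds its value at the vertices `i` and `j` by
`chordExcess t (f ∘ momentPoint) i j k` at the vertex `k`. -/
def tiltedFunctional (t : ℕ → ℝ) (i j : ℕ) : EuclideanSpace ℝ (Fin d) →ₗ[ℝ] ℝ :=
  (t j - t i) • f - (f (momentPoint d (t j)) - f (momentPoint d (t i))) • firstCoord hd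

/-- The common value of `tiltedFunctional` at the vertices `i` and `j`. -/
def tiltedValue (t : ℕ → ℝ) (i j : ℕ) : ℝ :=
  t j * f (momentPoint d (t i)) - t i * f (momentPoint d (t j))

variable {f}

theorem tiltedFunctional_momentPoint (i j k : ℕ) :
    tiltedFunctional hd f t i j (momentPoint d (t k)) =
      tiltedValue f t i j + chordExcess t (fun k => f (momentPoint d (t k))) i j k := by
  simp [tiltedFunctional, tiltedValue, chordExcess]
  ring

theorem tiltedFunctional_eq_of_mem {i j : ℕ} {x : EuclideanSpace ℝ (Fin d)}
    (hx : x ∈ momentSegment d t i j) :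
    tiltedFunctional hd f t i j x = tiltedValue f t i j := by
  obtain ⟨a, b, -, -, hab, rfl⟩ := hx
  rw [map_add, map_smul, map_smul, tiltedFunctional_momentPoint, tiltedFunctional_momentPoint]
  simp only [chordExcess, smul_eq_mul]
  linear_combination (tiltedValue f t i j) * hab

theorem mem_fiberMinFace_iff (ht : StrictMono t) {i j : ℕ} (hij : i < j) (hj : j ≤ N)
    (hw : ∀ k ≤ N, 0 ≤ chordExcess t (fun k => f (momentPoint d (t k))) i j k) {q : ℝ}
    (hq : t i ≤ q) (hq' : q ≤ t j) (x : EuclideanSpace ℝ (Fin d)) :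
    x ∈ fiberMinFace (momentPolytope d t N) (firstCoord hd) f q ↔
      x ∈ momentPolytope d t N ∧ firstCoord hd x = q ∧
        tiltedFunctional hd f t i j x = tiltedValue f t i j := by
  have hlt : 0 < t j - t i := sub_pos.2 (ht hij)
  have hge : ∀ y ∈ momentPolytope d t N, tiltedValue f t i j ≤ tiltedFunctional hd f t i j y := by
    intro y hy
    refine le_of_mem_convexHull _ ?_ hy
    rintro _ ⟨k, hk, rfl⟩
    simp only [tiltedFunctional_momentPoint]
    linarith [hw k hk]
  have hcmp : ∀ y z, firstCoord hd y = q → firstCoord hd z = q → (f y ≤ f z ↔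
      tiltedFunctional hd f t i j y ≤ tiltedFunctional hd f t i j z) := by
    intro y z hy hz
    simp only [tiltedFunctional, LinearMap.sub_apply, LinearMap.smul_apply, hy, hz, smul_eq_mul,
      sub_le_sub_iff_right]
    exact (mul_le_mul_iff_right₀ hlt).symm
  constructor
  · rintro ⟨⟨hx, hxq⟩, hmin⟩
    obtain ⟨y, hy, hyq⟩ := exists_mem_momentSegment_firstCoord hd hq hq'
    have hyP := momentSegment_subset (hij.le.trans hj) hj hy
    have := (hcmp x y hxq hyq).1 (hmin y ⟨hyP, hyq⟩)
    rw [tiltedFunctional_eq_of_mem hd hy] at this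
    exact ⟨hx, hxq, le_antisymm this (hge x hx)⟩
  · rintro ⟨hx, hxq, he⟩
    exact ⟨⟨hx, hxq⟩, fun y ⟨hy, hyq⟩ => (hcmp x y hxq hyq).2 (he ▸ hge y hy)⟩

/-- A point below all chords of a planar point set has a line through it below the whole set. -/
theorem exists_supporting_slope {w : ℕ → ℝ} {q h : ℝ}
    (hchord : ∀ k ≤ N, ∀ l ≤ N, t k < q → q < t l →
      (t l - t k) * h ≤ (t l - q) * w k + (q - t k) * w l)
    (heq : ∀ k ≤ N, t k = q → h ≤ w k) :
    ∃ b, ∀ k ≤ N, h + b * (t k - q) ≤ w k := by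
  -- Slopes to points on the left bound `b` from below, those to points on the right from above.
  let L := (Finset.range (N + 1)).filter fun k => t k < q
  let R := (Finset.range (N + 1)).filter fun k => q < t k
  let s : ℕ → ℝ := fun k => (w k - h) / (t k - q)
  have hLR : ∀ k ∈ L, ∀ l ∈ R, s k ≤ s l := by
    intro k hk l hl
    simp only [L, R, Finset.mem_filter, Finset.mem_range] at hk hl
    have h1 : 0 < q - t k := by linarith
    have h2 : 0 < t l - q := by linarith
    have e : s k = (h - w k) / (q - t k) := by
      rw [← neg_div_neg_eq, neg_sub, neg_sub]
    rw [e, div_le_div_iff₀ h1 h2]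
    have := hchord k (by omega) l (by omega) hk.2 hl.2
    linarith
  obtain ⟨b, hbL, hbR⟩ : ∃ b, (∀ k ∈ L, s k ≤ b) ∧ ∀ l ∈ R, b ≤ s l := by
    rcases L.eq_empty_or_nonempty with hL | hL
    · obtain ⟨b, hb⟩ := (R.image s).bddBelow
      exact ⟨b, by simp [hL], fun l hl => hb (by simpa using ⟨l, hl, rfl⟩)⟩
    · obtain ⟨k, hk, hmax⟩ := Finset.exists_max_image L s hL
      exact ⟨s k, hmax, hLR k hk⟩
  refine ⟨b, fun k hk => ?_⟩
  rcases lt_trichotomy (t k) q with hlt | he | hgt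
  · have := hbL k (by simp only [L, Finset.mem_filter, Finset.mem_range]; exact ⟨by omega, hlt⟩)
    rw [div_le_iff_of_neg (by linarith)] at this
    linarith
  · have := heq k hk he
    rw [he]; linarith
  · have := hbR k (by simp only [R, Finset.mem_filter, Finset.mem_range]; exact ⟨by omega, hgt⟩)
    rw [le_div_iff₀ (by linarith)] at this
    linarith

theorem HasLowerHull.chordExcess_nonneg {w : ℕ → ℝ} {A : Finset ℕ} (h : HasLowerHull t N A w)
    {i j : ℕ} (hij : Consecutive A i j) {k : ℕ} (hk : k ≤ N) : 0 ≤ chordExcess t w i j k := by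
  by_cases h1 : k = i
  · subst h1; simp [chordExcess]
  by_cases h2 : k = j
  · subst h2; simp [chordExcess]
  exact (h i j hij k hk h1 h2).le

/-- The segments between neighbours on a generic lower hull are faces. -/
theorem HasLowerHull.isPolytopeFace_momentSegment {A : Finset ℕ}
    (h : HasLowerHull t N A fun k => f (momentPoint d (t k))) (hA : ∀ k ∈ A, k ≤ N) {i j : ℕ}
    (hij : Consecutive A i j) :
    IsPolytopeFace (momentPolytope d t N) (momentSegment d t i j) ∧
    momentSegment d t i j = {x | x ∈ momentPolytope d t N ∧
      tiltedFunctional hd f t i j x = tiltedValue f t i j} := by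
  have hi := momentPoint_mem (d := d) (t := t) (hA i hij.1)
  have hface := isPolytopeFace_setOf_eq (V := (fun k => momentPoint d (t k)) '' Set.Iic N)
    (tiltedFunctional hd f t i j) (c := tiltedValue f t i j) (by
      rintro _ ⟨k, hk, rfl⟩
      simp only [tiltedFunctional_momentPoint]
      linarith [h.chordExcess_nonneg hij hk]) hi (by
      rw [tiltedFunctional_momentPoint]; simp [chordExcess])
  have heq : momentSegment d t i j = {x | x ∈ momentPolytope d t N ∧
      tiltedFunctional hd f t i j x = tiltedValue f t i j} := by
    refine Set.Subset.antisymm (fun x hx => ⟨momentSegment_subset (hA i hij.1) (hA j hij.2.1) hx,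
      tiltedFunctional_eq_of_mem hd hx⟩) ?_
    have := hface.eq_convexHull finite_momentPoints
    rw [show {x | x ∈ momentPolytope d t N ∧
      tiltedFunctional hd f t i j x = tiltedValue f t i j} = _ from this, momentSegment,
      ← convexHull_pair]
    refine convexHull_mono ?_
    rintro _ ⟨⟨k, hk, rfl⟩, -, hk'⟩
    simp only [tiltedFunctional_momentPoint] at hk'
    by_cases h1 : k = i
    · subst h1; exact Or.inl rfl
    by_cases h2 : k = j
    · subst h2; exact Or.inr rfl
    have := h i j hij k hk h1 h2
    linarith
  exact ⟨heq ▸ hface, heq⟩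

theorem momentSegment_subset_iff (ht : StrictMono t) {A : Finset ℕ} {i j i' j' : ℕ}
    (h : Consecutive A i j) (h' : Consecutive A i' j')
    (hsub : momentSegment d t i j ⊆ momentSegment d t i' j') (hd : 2 ≤ d) :
    i = i' ∧ j = j' := by
  have h1 := eq_or_eq_of_mem_momentSegment hd ht (hsub (left_mem_segment ℝ _ _))
  have h2 := eq_or_eq_of_mem_momentSegment hd ht (hsub (right_mem_segment ℝ _ _))
  have := h.2.2.1
  have := h'.2.2.1
  omega

/-- A generic lower hull cuts out the segments between its neighbouring vertices as the maximal
cells of the coherent subdivision. -/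
theorem HasLowerHull.maximal_iff (ht : StrictMono t) {A : Finset ℕ}
    (h : HasLowerHull t N A fun k => f (momentPoint d (t k))) (h0 : 0 ∈ A) (hN : N ∈ A)
    (hpos : 0 < N) (hA : ∀ k ∈ A, k ≤ N) (F : Set (EuclideanSpace ℝ (Fin d))) :
    Maximal (· ∈ coherentSubdivision (momentPolytope d t N) (firstCoord hd) f) F ↔
      ∃ i j, Consecutive A i j ∧ F = momentSegment d t i j := by
  have hcell : ∀ i j, Consecutive A i j →
      momentSegment d t i j ∈ coherentSubdivision (momentPolytope d t N) (firstCoord hd) f := by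
    intro i j hij
    have hlt := ht hij.2.2.1
    obtain ⟨α, β, -, -, -, -, hx, hxq⟩ := exists_mem_openSegment_firstCoord hd
      (t := t) (a := i) (b := j) (q := (t i + t j) / 2) (by linarith) (by linarith)
    have hxs := openSegment_subset_segment ℝ _ _ hx
    have hxP := momentSegment_subset (hA i hij.1) (hA j hij.2.1) hxs
    have hiff := mem_fiberMinFace_iff hd ht hij.2.2.1 (hA j hij.2.1)
      (fun k hk => h.chordExcess_nonneg hij hk) (q := (t i + t j) / 2) (by linarith) (by linarith)
    obtain ⟨hface, heq⟩ := h.isPolytopeFace_momentSegment hd hA hij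
    refine ⟨_, ⟨_, hxP, hxq⟩, ⟨hface, fun y hy => ?_⟩, fun G hG => ?_⟩
    · rw [heq]
      have := (hiff y).1 hy
      exact ⟨this.1, this.2.2⟩
    · exact hG.1.segment_subset convex_momentPolytope (momentPoint_mem (hA i hij.1))
        (momentPoint_mem (hA j hij.2.1))
        (hG.2 ((hiff _).2 ⟨hxP, hxq, tiltedFunctional_eq_of_mem hd hxs⟩)) hx
  have hsub : ∀ G ∈ coherentSubdivision (momentPolytope d t N) (firstCoord hd) f,
      ∃ i j, Consecutive A i j ∧ G ⊆ momentSegment d t i j := by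
    rintro G ⟨q, ⟨x, hx, rfl⟩, hG⟩
    obtain ⟨hx1, hx2⟩ := firstCoord_mem_Icc hd ht hx
    obtain ⟨i, j, hij, hi, hj⟩ := exists_consecutive_Icc ht h0 hN hpos hx1 hx2
    obtain ⟨hface, heq⟩ := h.isPolytopeFace_momentSegment hd hA hij
    refine ⟨i, j, hij, hG.2 ⟨hface, fun y hy => ?_⟩⟩
    have := (mem_fiberMinFace_iff hd ht hij.2.2.1 (hA j hij.2.1)
      (fun k hk => h.chordExcess_nonneg hij hk) hi hj y).1 hy
    rw [heq]
    exact ⟨this.1, this.2.2⟩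
  constructor
  · intro hF
    obtain ⟨i, j, hij, hFij⟩ := hsub F hF.prop
    exact ⟨i, j, hij, Set.Subset.antisymm hFij (hF.le_of_ge (hcell i j hij) hFij)⟩
  · rintro ⟨i, j, hij, rfl⟩
    refine ⟨hcell i j hij, fun G hG hle => ?_⟩
    obtain ⟨i', j', hij', hG'⟩ := hsub G hG
    obtain ⟨rfl, rfl⟩ := momentSegment_subset_iff ht hij hij' (hle.trans hG') hd
    exact hG'

/-- A cell of the coherent subdivision that is a segment between two vertices lies on the lower
hull. -/
theorem chordExcess_nonneg_of_mem_coherentSubdivision (ht : StrictMono t) {i j : ℕ} (hij : i < j)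
    (h : momentSegment d t i j ∈
      coherentSubdivision (momentPolytope d t N) (firstCoord hd) f) {k : ℕ} (hk : k ≤ N) :
    0 ≤ chordExcess t (fun k => f (momentPoint d (t k))) i j k := by
  obtain ⟨q, ⟨y, hy, hyq⟩, hleast⟩ := h
  have hcomp : IsCompact (momentPolytope d t N ∩ {x | firstCoord hd x = q}) :=
    (finite_momentPoints.isCompact_convexHull (𝕜 := ℝ)).inter_right
      (isClosed_eq (LinearMap.continuous_of_finiteDimensional _) continuous_const)
  obtain ⟨x, ⟨hxP, hxq⟩, hmin⟩ := hcomp.exists_isMinOn ⟨y, hy, hyq⟩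
    (LinearMap.continuous_of_finiteDimensional f).continuousOn
  have hmin' : ∀ z, z ∈ momentPolytope d t N → firstCoord hd z = q → f x ≤ f z :=
    fun z hz hzq => hmin ⟨hz, hzq⟩
  obtain ⟨b, hb⟩ := exists_supporting_slope (t := t) (N := N) (q := q) (h := f x)
    (w := fun k => f (momentPoint d (t k)))
    (fun k hk l hl h1 h2 => by
      obtain ⟨α, β, -, -, hαβ, hsum, hz, hzq⟩ := exists_mem_openSegment_firstCoord hd h1 h2
      have := hmin' _ (momentSegment_subset hk hl (openSegment_subset_segment ℝ _ _ hz)) hzq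
      rw [map_add, map_smul, map_smul, smul_eq_mul, smul_eq_mul] at this
      have hlt : 0 ≤ t l - t k := by linarith
      have h3 := mul_le_mul_of_nonneg_left this hlt
      obtain rfl : β = 1 - α := by linarith
      refine h3.trans_eq ?_
      linear_combination (f (momentPoint d (t l)) - f (momentPoint d (t k))) * hsum)
    (fun k hk he => hmin' _ (momentPoint_mem hk) (by simpa using he))
  have hg : ∀ z, (f - b • firstCoord hd) z = f z - b * firstCoord hd z := fun z => by simp
  have hface := isPolytopeFace_setOf_eq (V := (fun k => momentPoint d (t k)) '' Set.Iic N)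
    (f - b • firstCoord hd) (c := f x - b * q) (by
      rintro _ ⟨k, hk, rfl⟩
      simp only [hg, firstCoord_momentPoint]
      linarith [hb k hk]) hxP (by rw [hg, hxq])
  have hsub := hleast.2 ⟨hface, fun z ⟨⟨hz, hzq⟩, hzmin⟩ => ⟨hz, by
    rw [hg, hzq, le_antisymm (hzmin x ⟨hxP, hxq⟩) (hmin' z hz hzq)]⟩⟩
  have hi := (hsub (left_mem_segment ℝ _ _)).2
  have hj := (hsub (right_mem_segment ℝ _ _)).2
  simp only [hg, firstCoord_momentPoint] at hi hj
  have hlt : 0 ≤ t j - t i := (sub_pos.2 (ht hij)).le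
  have := mul_nonneg hlt (sub_nonneg.2 (hb k hk))
  refine this.trans_eq ?_
  simp only [chordExcess]
  linear_combination (t j - t k) * hi + (t k - t i) * hj

/-- If the maximal cells of a coherent subdivision are the segments between neighbours of `A`,
then `A` is the lower hull: a further vertex on a hull line would enlarge some cell. -/
theorem hasLowerHull_of_maximal (ht : StrictMono t) {A : Finset ℕ} (hA : ∀ k ∈ A, k ≤ N)
    (h : ∀ i j, Consecutive A i j →
      Maximal (· ∈ coherentSubdivision (momentPolytope d t N) (firstCoord hd) f)
        (momentSegment d t i j)) :
    HasLowerHull t N A fun k => f (momentPoint d (t k)) := by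
  intro i j hij k hk hki hkj
  have hlt := ht hij.2.2.1
  have hjN := hA j hij.2.1
  have hiN := hA i hij.1
  have hw : ∀ k ≤ N, 0 ≤ chordExcess t (fun k => f (momentPoint d (t k))) i j k := fun k hk =>
    chordExcess_nonneg_of_mem_coherentSubdivision hd ht hij.2.2.1 (h i j hij).prop hk
  refine lt_of_le_of_ne (hw k hk) fun hzero => ?_
  -- Over some `q` between `t i` and `t j` there is also a chord that ends at `k`.
  obtain ⟨a, b, q, ha, hb, hkab, hE, hiq, hqj, haq, hqb⟩ : ∃ a b q, a ≤ N ∧ b ≤ N ∧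
      (k = a ∨ k = b) ∧ (∀ x ∈ momentSegment d t a b,
        tiltedFunctional hd f t i j x = tiltedValue f t i j) ∧
      t i < q ∧ q < t j ∧ t a < q ∧ q < t b := by
    have hlin : ∀ a b, chordExcess t (fun k => f (momentPoint d (t k))) i j a = 0 →
        chordExcess t (fun k => f (momentPoint d (t k))) i j b = 0 →
        ∀ x ∈ momentSegment d t a b, tiltedFunctional hd f t i j x = tiltedValue f t i j := by
      rintro a b ha hb _ ⟨α, β, -, -, hαβ, rfl⟩
      rw [map_add, map_smul, map_smul, tiltedFunctional_momentPoint, tiltedFunctional_momentPoint,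
        ha, hb, smul_eq_mul, smul_eq_mul]
      linear_combination (tiltedValue f t i j) * hαβ
    have ei : chordExcess t (fun k => f (momentPoint d (t k))) i j i = 0 := by simp [chordExcess]
    have ej : chordExcess t (fun k => f (momentPoint d (t k))) i j j = 0 := by simp [chordExcess]
    rcases lt_or_gt_of_ne hki with h1 | h1
    · have := ht h1
      exact ⟨k, j, (t i + t j) / 2, hk, hjN, Or.inl rfl, hlin k j hzero.symm ej, by linarith,
        by linarith, by linarith, by linarith⟩
    · have := ht h1
      refine ⟨i, k, (t i + min (t j) (t k)) / 2, hiN, hk, Or.inr rfl,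
        hlin i k ei hzero.symm, ?_, ?_, ?_, ?_⟩ <;>
      linarith [lt_min hlt this, min_le_left (t j) (t k), min_le_right (t j) (t k)]
  obtain ⟨α, β, -, -, -, -, hx, hxq⟩ := exists_mem_openSegment_firstCoord hd hiq hqj
  obtain ⟨α', β', -, -, -, -, hy, hyq⟩ := exists_mem_openSegment_firstCoord hd haq hqb
  have hxs := openSegment_subset_segment ℝ _ _ hx
  have hys := openSegment_subset_segment ℝ _ _ hy
  have hxP := momentSegment_subset hiN hjN hxs
  have hyP := momentSegment_subset ha hb hys
  have hiff := mem_fiberMinFace_iff hd ht hij.2.2.1 hjN hw hiq.le hqj.le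
  have hxm := (hiff _).2 ⟨hxP, hxq, tiltedFunctional_eq_of_mem hd hxs⟩
  have hym := (hiff _).2 ⟨hyP, hyq, hE _ hys⟩
  obtain ⟨F, hF⟩ := exists_isLeast_face (X := fiberMinFace (momentPolytope d t N)
    (firstCoord hd) f q) finite_momentPoints ⟨_, hxm⟩ fun z hz => hz.1.1
  have h1 : momentSegment d t i j ⊆ F := hF.1.1.segment_subset convex_momentPolytope
    (momentPoint_mem hiN) (momentPoint_mem hjN) (hF.1.2 hxm) hx
  have h2 : momentSegment d t a b ⊆ F := hF.1.1.segment_subset convex_momentPolytope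
    (momentPoint_mem ha) (momentPoint_mem hb) (hF.1.2 hym) hy
  have hFij : F ⊆ momentSegment d t i j := (h i j hij).le_of_ge ⟨q, ⟨_, hxP, hxq⟩, hF⟩ h1
  have hkF : momentPoint d (t k) ∈ F := by
    rcases hkab with rfl | rfl
    · exact h2 (left_mem_segment ℝ _ _)
    · exact h2 (right_mem_segment ℝ _ _)
  rcases eq_or_eq_of_mem_momentSegment hd ht (hFij hkF) with h | h
  · exact hki h
  · exact hkj h

end

/-! ### Monotone edge paths as vertex sets -/

section

variable {d : ℕ} (hd : 2 ≤ d) {t : ℕ → ℝ} {N : ℕ}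

/-- The list of segments between successive entries of a list of vertex indices. -/
def segmentList (d : ℕ) (t : ℕ → ℝ) : List ℕ → List (Set (EuclideanSpace ℝ (Fin d)))
  | i :: j :: l => momentSegment d t i j :: segmentList d t (j :: l)
  | _ => []

/-- The path through the vertices with indices in `A`, in increasing order. -/
def vertexPath (d : ℕ) (t : ℕ → ℝ) (A : Finset ℕ) : List (Set (EuclideanSpace ℝ (Fin d))) :=
  segmentList d t (A.sort (· ≤ ·))

theorem mem_segmentList_iff {l : List ℕ} (hl : l.Pairwise (· < ·))
    (F : Set (EuclideanSpace ℝ (Fin d))) :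
    F ∈ segmentList d t l ↔ ∃ i j, Consecutive l.toFinset i j ∧ F = momentSegment d t i j := by
  induction l with
  | nil => simp [segmentList, Consecutive]
  | cons i l ih =>
    cases l with
    | nil =>
      simp only [segmentList, List.not_mem_nil, false_iff]
      rintro ⟨a, b, ⟨ha, hb, hab, -⟩, -⟩
      simp at ha hb
      omega
    | cons j l =>
      rw [List.pairwise_cons] at hl
      have hij : i < j := hl.1 j (by simp)
      have hjl : ∀ k ∈ (j :: l), j ≤ k := by
        intro k hk
        rcases List.mem_cons.1 hk with rfl | hk
        · exact le_rfl
        · exact ((List.pairwise_cons.1 hl.2).1 k hk).le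
      rw [segmentList, List.mem_cons, ih hl.2]
      constructor
      · rintro (rfl | ⟨a, b, ⟨ha, hb, hab, hc⟩, rfl⟩)
        · refine ⟨i, j, ⟨by simp, by simp, hij, fun k h1 h2 hk => ?_⟩, rfl⟩
          rw [List.mem_toFinset, List.mem_cons] at hk
          rcases hk with rfl | hk
          · exact lt_irrefl _ h1
          · have := hjl k hk
            omega
        · rw [List.mem_toFinset] at ha hb
          refine ⟨a, b, ⟨by simp [List.mem_cons.1 ha], by simp [List.mem_cons.1 hb], hab,
            fun k h1 h2 hk => ?_⟩, rfl⟩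
          rw [List.mem_toFinset, List.mem_cons] at hk
          rcases hk with rfl | hk
          · have := hl.1 a ha
            omega
          · exact hc k h1 h2 (List.mem_toFinset.2 hk)
      · rintro ⟨a, b, hab, rfl⟩
        have hb := hab.2.1
        have ha := hab.1
        rw [List.mem_toFinset, List.mem_cons] at ha hb
        have hb' : b ∈ j :: l := by
          rcases hb with rfl | hb
          · exfalso
            have h1 := hab.2.2.1
            rcases ha with rfl | ha
            · omega
            · have := hl.1 a ha
              omega
          · exact hb
        rcases ha with rfl | ha
        · left
          have h1 := hjl b hb'
          rcases hab.le_or_le (a := j) (by simp) with h | h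
          · omega
          · rw [le_antisymm h h1]
        · right
          refine ⟨a, b, ⟨List.mem_toFinset.2 ha, List.mem_toFinset.2 hb', hab.2.2.1,
            fun k h1 h2 hk => hab.2.2.2 k h1 h2 ?_⟩, rfl⟩
          rw [List.mem_toFinset] at hk ⊢
          exact List.mem_cons_of_mem _ hk

theorem mem_vertexPath_iff (A : Finset ℕ) (F : Set (EuclideanSpace ℝ (Fin d))) :
    F ∈ vertexPath d t A ↔ ∃ i j, Consecutive A i j ∧ F = momentSegment d t i j := by
  rw [vertexPath, mem_segmentList_iff (Finset.sortedLT_sort A).pairwise, Finset.sort_toFinset]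

theorem isLeast_isGreatest_image_momentSegment (ht : StrictMono t) {i j : ℕ} (hij : i < j) :
    IsLeast (firstCoord hd '' momentSegment d t i j) (t i) ∧
      IsGreatest (firstCoord hd '' momentSegment d t i j) (t j) := by
  have := isLeast_isGreatest_image_segment (firstCoord hd) (x := momentPoint d (t i))
    (y := momentPoint d (t j)) (by simpa using (ht hij).le)
  simpa [momentSegment] using this

/-- A chain of edges with matching end points is the path through an increasing list of vertices. -/
theorem exists_eq_segmentList (ht : StrictMono t) (σ : List (Set (EuclideanSpace ℝ (Fin d))))
    (F : Set (EuclideanSpace ℝ (Fin d)))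
    (hseg : ∀ G ∈ F :: σ, ∃ i j, i < j ∧ j ≤ N ∧ G = momentSegment d t i j)
    (hchain : (F :: σ).IsChain fun F G => ∃ c, IsGreatest (firstCoord hd '' F) c ∧
      IsLeast (firstCoord hd '' G) c) :
    ∃ i j l, (i :: j :: l).Pairwise (· < ·) ∧ (∀ k ∈ i :: j :: l, k ≤ N) ∧
      F :: σ = segmentList d t (i :: j :: l) := by
  induction σ generalizing F with
  | nil =>
    obtain ⟨i, j, hij, hj, rfl⟩ := hseg F (by simp)
    exact ⟨i, j, [], by simpa using hij, by simp; omega, rfl⟩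
  | cons G σ ih =>
    obtain ⟨i, j, hij, hj, rfl⟩ := hseg F (by simp)
    rw [List.isChain_cons_cons] at hchain
    obtain ⟨a, b, l, hl, hlN, hσ⟩ := ih G
      (fun H hH => hseg H (List.mem_cons_of_mem _ hH)) hchain.2
    obtain ⟨c, hc1, hc2⟩ := hchain.1
    obtain rfl : G = momentSegment d t a b := (List.cons.inj hσ).1
    have hab : a < b := (List.pairwise_cons.1 hl).1 b (by simp)
    have h1 := hc1.unique (isLeast_isGreatest_image_momentSegment hd ht hij).2
    have h2 := hc2.unique (isLeast_isGreatest_image_momentSegment hd ht hab).1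
    obtain rfl : j = a := ht.injective (h1.symm.trans h2)
    refine ⟨i, j, b :: l, List.pairwise_cons.2 ⟨fun k hk => ?_, hl⟩, fun k hk => ?_, ?_⟩
    · rcases List.mem_cons.1 hk with rfl | hk
      · exact hij
      · exact hij.trans ((List.pairwise_cons.1 hl).1 k hk)
    · rcases List.mem_cons.1 hk with rfl | hk
      · omega
      · exact hlN k hk
    · rw [hσ]; rfl

theorem getLast?_segmentList (i j : ℕ) (l : List ℕ) :
    ∃ a, (segmentList d t (i :: j :: l)).getLast? =
      some (momentSegment d t a ((j :: l).getLast (by simp))) ∧ a ∈ i :: j :: l := by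
  induction l generalizing i j with
  | nil => exact ⟨i, by simp [segmentList]⟩
  | cons k l ih =>
    obtain ⟨a, h, ha⟩ := ih j k
    refine ⟨a, ?_, List.mem_cons_of_mem _ ha⟩
    rw [segmentList, List.getLast?_cons, h]
    simp

theorem isChain_segmentList (ht : StrictMono t) {l : List ℕ} (hl : l.Pairwise (· < ·)) :
    (segmentList d t l).IsChain fun F G => ∃ c, IsGreatest (firstCoord hd '' F) c ∧
      IsLeast (firstCoord hd '' G) c := by
  induction l with
  | nil => simp [segmentList]
  | cons i l ih =>
    cases l with
    | nil => simp [segmentList]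
    | cons j l =>
      have hij : i < j := (List.pairwise_cons.1 hl).1 j (by simp)
      have ih' := ih (List.pairwise_cons.1 hl).2
      cases l with
      | nil => simp [segmentList]
      | cons k l =>
        have hjk : j < k := (List.pairwise_cons.1 (List.pairwise_cons.1 hl).2).1 k (by simp)
        rw [segmentList, segmentList, List.isChain_cons_cons]
        exact ⟨⟨t j, (isLeast_isGreatest_image_momentSegment hd ht hij).2,
          (isLeast_isGreatest_image_momentSegment hd ht hjk).1⟩, ih'⟩

/-- Every monotone edge path is the path through a set of vertices that contains both end
vertices. -/
theorem exists_vertexPath (ht : StrictMono t) {σ : List (Set (EuclideanSpace ℝ (Fin d)))}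
    (hσ : IsCellularString (momentPolytope d t N) (firstCoord hd) (momentPoint d (t 0))
      (momentPoint d (t N)) σ) (hedge : ∀ F ∈ σ, IsPolytopeEdge (momentPolytope d t N) F) :
    ∃ A : Finset ℕ, 0 ∈ A ∧ N ∈ A ∧ (∀ k ∈ A, k ≤ N) ∧ σ = vertexPath d t A := by
  cases σ with
  | nil => obtain ⟨F, hF, -⟩ := hσ.first; simp at hF
  | cons F σ =>
    obtain ⟨i, j, l, hl, hlN, hE⟩ := exists_eq_segmentList (N := N) hd ht σ F
      (fun G hG => (hedge G hG).exists_eq_momentSegment hd ht) hσ.chain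
    have hij : i < j := (List.pairwise_cons.1 hl).1 j (by simp)
    refine ⟨(i :: j :: l).toFinset, ?_, ?_, by simpa using hlN, ?_⟩
    · obtain ⟨G, hG, h0⟩ := hσ.first
      rw [hE] at hG
      simp only [segmentList, List.head?_cons, Option.mem_def, Option.some.injEq] at hG
      rw [← hG] at h0
      rcases eq_or_eq_of_mem_momentSegment hd ht h0 with h | h
      · simp [h]
      · omega
    · obtain ⟨G, hG, hN⟩ := hσ.last
      obtain ⟨a, ha, ha'⟩ := getLast?_segmentList (d := d) (t := t) i j l
      rw [hE, ha, Option.mem_def, Option.some.injEq] at hG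
      rw [← hG] at hN
      rcases eq_or_eq_of_mem_momentSegment hd ht hN with h | h
      · rw [h]; exact List.mem_toFinset.2 ha'
      · rw [h]; exact List.mem_toFinset.2 (List.mem_cons_of_mem _ (List.getLast_mem _))
    · rw [hE, vertexPath, (List.toFinset_sort (r := (· ≤ ·)) (hl.imp fun h => h.ne)).2
        (hl.imp fun h => h.le)]

theorem isCellularString_vertexPath (ht : StrictMono t) {A : Finset ℕ} (h0 : 0 ∈ A) (hN : N ∈ A)
    (hpos : 0 < N) (hA : ∀ k ∈ A, k ≤ N)
    (hface : ∀ i j, Consecutive A i j →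
      IsPolytopeFace (momentPolytope d t N) (momentSegment d t i j)) :
    IsCellularString (momentPolytope d t N) (firstCoord hd) (momentPoint d (t 0))
      (momentPoint d (t N)) (vertexPath d t A) := by
  have hl := (Finset.sortedLT_sort A).pairwise
  have hmem : ∀ k, k ∈ A.sort (· ≤ ·) ↔ k ∈ A := fun k => Finset.mem_sort _
  refine ⟨?_, ?_, ?_, isChain_segmentList hd ht hl⟩
  · intro F hF
    obtain ⟨i, j, hij, rfl⟩ := (mem_vertexPath_iff A F).1 hF
    exact hface i j hij
  all_goals
    rw [vertexPath]
    generalize A.sort (· ≤ ·) = l at hl hmem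
    match l, hl, hmem with
    | [], _, hmem => exact absurd ((hmem 0).2 h0) (by simp)
    | [i], _, hmem =>
      have h1 := (hmem 0).2 h0
      have h2 := (hmem N).2 hN
      simp at h1 h2
      omega
    | i :: j :: l, hl, hmem => ?_
  · have hi : i = 0 := by
      rcases List.mem_cons.1 ((hmem 0).2 h0) with h | h
      · exact h.symm
      · exact absurd ((List.pairwise_cons.1 hl).1 0 h) (by omega)
    exact ⟨_, rfl, hi ▸ left_mem_segment ℝ _ _⟩
  · obtain ⟨a, ha, -⟩ := getLast?_segmentList (d := d) (t := t) i j l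
    have hlast : (j :: l).getLast (by simp) = N := by
      have h1 : (j :: l).getLast (by simp) ∈ j :: l := List.getLast_mem _
      refine le_antisymm (hA _ ((hmem _).1 (List.mem_cons_of_mem _ h1))) ?_
      exact (hl.imp fun h => h.le).rel_getLast ((hmem N).2 hN)
    rw [hlast] at ha
    exact ⟨_, ha, right_mem_segment ℝ _ _⟩

end

/-! ### Runs of sign vectors -/

section

/-- A run is determined by its first entry, which is either entry `0` or follows a change. -/
theorem numRuns_eq {m : ℕ} (s : Fin (m + 1) → SignType) :
    numRuns s = (Finset.univ.filter fun k : Fin m => s k.castSucc ≠ s k.succ).card + 1 := by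
  let run : Fin (m + 1) → Set (Fin (m + 1)) := fun a => {j | ∀ i ∈ Set.uIcc a j, s i = s a}
  let T : Finset (Fin (m + 1)) :=
    insert 0 ((Finset.univ.filter fun k : Fin m => s k.castSucc ≠ s k.succ).map (Fin.succEmb m))
  have hT : T.card = (Finset.univ.filter fun k : Fin m => s k.castSucc ≠ s k.succ).card + 1 := by
    rw [Finset.card_insert_of_notMem (by simp), Finset.card_map]
  have hself : ∀ a, a ∈ run a := by
    intro a i hi
    rw [Set.uIcc_self, Set.mem_singleton_iff] at hi
    rw [hi]
  have hprop : ∀ a, (run a).Nonempty ∧ (run a).OrdConnected ∧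
      ∀ i ∈ run a, ∀ j ∈ run a, s i = s j := by
    refine fun a => ⟨⟨a, hself a⟩, ⟨fun x hx y hy z hz i hi => ?_⟩, fun i hi j hj => ?_⟩
    · rcases le_total a z with h | h
      · refine hy i ?_
        rw [Set.uIcc_of_le h] at hi
        rw [Set.uIcc_of_le (h.trans hz.2)]
        exact ⟨hi.1, hi.2.trans hz.2⟩
      · refine hx i ?_
        rw [Set.uIcc_of_ge h] at hi
        rw [Set.uIcc_of_ge (hz.1.trans h)]
        exact ⟨hz.1.trans hi.1, hi.2⟩
    · rw [hi i Set.right_mem_uIcc, hj j Set.right_mem_uIcc]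
  have hsub : ∀ (J : Set (Fin (m + 1))) a, J.OrdConnected → (∀ i ∈ J, ∀ j ∈ J, s i = s j) →
      a ∈ J → J ⊆ run a := fun J a hJ hc ha j hj i hi =>
    hc i (hJ.uIcc_subset ha hj hi) a ha
  have himage : {I : Set (Fin (m + 1)) |
      Maximal (fun J => J.Nonempty ∧ J.OrdConnected ∧ ∀ i ∈ J, ∀ j ∈ J, s i = s j) I} =
      run '' T := by
    ext I
    constructor
    · intro hI
      rw [Set.mem_ofPred_eq] at hI
      obtain ⟨a, ha, hmin⟩ := Set.exists_min_image I id (Set.toFinite I) hI.prop.1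
      have hIa : I = run a := (hI.eq_of_le (hprop a) (hsub I a hI.prop.2.1 hI.prop.2.2 ha))
      refine ⟨a, ?_, hIa.symm⟩
      rcases Fin.eq_zero_or_eq_succ a with rfl | ⟨k, rfl⟩
      · simp [T]
      · simp only [T, Finset.coe_insert, Set.mem_insert_iff, Finset.mem_coe, Finset.mem_map,
          Finset.mem_filter, Finset.mem_univ, true_and]
        refine Or.inr ⟨k, fun he => ?_, rfl⟩
        have hk : k.castSucc ∈ I := by
          rw [hIa]
          intro i hi
          rw [Set.uIcc_of_ge (Fin.castSucc_lt_succ).le] at hi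
          rcases hi.1.eq_or_lt with h | h
          · rw [← h, he]
          · rw [le_antisymm hi.2 (Fin.castSucc_lt_iff_succ_le.1 h)]
        exact absurd (hmin _ hk) (not_le.2 Fin.castSucc_lt_succ)
    · rintro ⟨a, -, rfl⟩
      exact ⟨hprop a, fun J hJ hle => hsub J a hJ.2.1 hJ.2.2 (hle (hself a))⟩
  have hinj : ∀ a b, a < b → b ∈ T → run a ≠ run b := by
    intro a b hab hb he
    have hba : b ∈ run a := he ▸ hself b
    rcases Fin.eq_zero_or_eq_succ b with rfl | ⟨k, rfl⟩
    · exact absurd hab (Fin.not_lt_zero a)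
    · simp only [T, Finset.mem_insert, Fin.succ_ne_zero, Finset.mem_map, Finset.mem_filter,
        Finset.mem_univ, true_and, false_or, Fin.coe_succEmb, Fin.succ_inj,
        exists_eq_right] at hb
      refine hb ?_
      rw [hba k.succ Set.right_mem_uIcc, hba k.castSucc]
      rw [Set.uIcc_of_le hab.le]
      exact ⟨Fin.le_castSucc_iff.2 hab, Fin.castSucc_lt_succ.le⟩
  rw [numRuns, himage, Set.InjOn.ncard_image, Set.ncard_coe_finset, hT]
  intro a ha b hb he
  rcases lt_trichotomy a b with h | h | h
  · exact absurd he (hinj a b h hb)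
  · exact h
  · exact absurd he.symm (hinj b a h ha)

/-- A two-valued sequence is determined by its first entry and the positions of its changes. -/
theorem card_filter_changes_lt (m e : ℕ) :
    (Finset.univ.filter fun b : Fin (m + 1) → Bool =>
      (Finset.univ.filter fun k : Fin m => b k.castSucc ≠ b k.succ).card < e).card =
      2 * ∑ j ∈ Finset.range e, m.choose j := by
  let Φ : (Fin (m + 1) → Bool) → Bool × Finset (Fin m) := fun b =>
    (b 0, Finset.univ.filter fun k : Fin m => b k.castSucc ≠ b k.succ)
  have hΦ : Φ.Bijective := by
    rw [Fintype.bijective_iff_injective_and_card]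
    refine ⟨fun b b' h => ?_, by simp [pow_succ, mul_comm]⟩
    simp only [Φ, Prod.mk.injEq] at h
    funext i
    induction i using Fin.induction with
    | zero => exact h.1
    | succ k ih =>
      have hk := Finset.ext_iff.1 h.2 k
      simp only [Finset.mem_filter, Finset.mem_univ, true_and, ih] at hk
      revert hk
      cases b' k.castSucc <;> cases b k.succ <;> cases b' k.succ <;> simp
  have h1 : (Finset.univ.filter fun b : Fin (m + 1) → Bool =>
      (Finset.univ.filter fun k : Fin m => b k.castSucc ≠ b k.succ).card < e).card =
      ((Finset.univ : Finset Bool) ×ˢ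
        (Finset.univ : Finset (Finset (Fin m))).filter fun D => D.card < e).card := by
    refine Finset.card_bijective Φ hΦ fun b => ?_
    simp [Φ]
  have h2 : ((Finset.univ : Finset (Finset (Fin m))).filter fun D => D.card < e).card =
      ∑ j ∈ Finset.range e, m.choose j := by
    rw [Finset.card_eq_sum_card_fiberwise (f := Finset.card) (t := Finset.range e)
      (fun D hD => by simpa using hD)]
    refine Finset.sum_congr rfl fun j hj => ?_
    have : ((Finset.univ : Finset (Finset (Fin m))).filter fun D => D.card < e).filter
        (fun D => D.card = j) = Finset.powersetCard j Finset.univ := by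
      ext D
      have := Finset.mem_range.1 hj
      simp only [Finset.mem_filter, Finset.mem_univ, true_and, Finset.mem_powersetCard,
        Finset.subset_univ]
      omega
    rw [this, Finset.card_powersetCard, Finset.card_univ, Fintype.card_fin]
  rw [h1, Finset.card_product, h2]
  simp

theorem ncard_setOf_numRuns_lt (m e : ℕ) :
    {s : Fin (m + 1) → SignType | (∀ i, s i ≠ 0) ∧ numRuns s ≤ e}.ncard =
      2 * ∑ j ∈ Finset.range e, m.choose j := by
  let φ : (Fin (m + 1) → Bool) → Fin (m + 1) → SignType := fun b i => if b i then 1 else -1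
  have hφ : ∀ b i j, (φ b i = φ b j ↔ b i = b j) := by
    intro b i j
    simp only [φ]
    cases b i <;> cases b j <;> simp
  have hruns : ∀ b, numRuns (φ b) =
      (Finset.univ.filter fun k : Fin m => b k.castSucc ≠ b k.succ).card + 1 := by
    intro b
    rw [numRuns_eq]
    simp only [ne_eq, hφ]
  have hset : {s : Fin (m + 1) → SignType | (∀ i, s i ≠ 0) ∧ numRuns s ≤ e} =
      φ '' ((Finset.univ.filter fun b : Fin (m + 1) → Bool =>
        (Finset.univ.filter fun k : Fin m => b k.castSucc ≠ b k.succ).card < e :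
        Finset _) : Set (Fin (m + 1) → Bool)) := by
    ext s
    constructor
    · rintro ⟨hs, hr⟩
      have hb : φ (fun i => decide (s i = 1)) = s := by
        funext i
        have hx : ∀ x : SignType, x ≠ 0 → (if decide (x = 1) then (1 : SignType) else -1) = x := by
          decide
        exact hx _ (hs i)
      rw [← hb, hruns] at hr
      exact ⟨fun i => decide (s i = 1),
        Finset.mem_coe.2 (Finset.mem_filter.2 ⟨Finset.mem_univ _, hr⟩), hb⟩
    · rintro ⟨b, hb, rfl⟩
      refine ⟨fun i => ?_, ?_⟩
      · simp only [φ]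
        cases b i <;> decide
      · rw [hruns]
        exact (Finset.mem_filter.1 (Finset.mem_coe.1 hb)).2
  have hinj : φ.Injective := by
    intro b b' h
    funext i
    have := congrFun h i
    revert this
    simp only [φ]
    cases b i <;> cases b' i <;> decide
  rw [hset, Set.ncard_image_of_injective _ hinj, Set.ncard_coe_finset, card_filter_changes_lt]

end

/-! ### Coherent paths and their sign vectors -/

section

variable {d : ℕ} (hd : 2 ≤ d) {t : ℕ → ℝ} {m : ℕ}

/-- A linear functional is a polynomial of degree at most `d` along the moment curve. -/
theorem exists_polynomial_eval_eq (f : EuclideanSpace ℝ (Fin d) →ₗ[ℝ] ℝ) :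
    ∃ p : Polynomial ℝ, p.natDegree ≤ d ∧ ∀ x, p.eval x = f (momentPoint d x) := by
  refine ⟨∑ i : Fin d, Polynomial.monomial (i.val + 1) (f (EuclideanSpace.single i 1)), ?_,
    fun x => ?_⟩
  · exact Polynomial.natDegree_sum_le_of_forall_le _ _ fun i _ =>
      (Polynomial.natDegree_monomial_le _).trans i.isLt
  · have hx : momentPoint d x = ∑ i : Fin d, x ^ (i.val + 1) • EuclideanSpace.single i (1 : ℝ) := by
      ext j
      simp [momentPoint, Pi.single_apply]
    rw [hx, map_sum, Polynomial.eval_finsetSum]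
    refine Finset.sum_congr rfl fun i _ => ?_
    rw [Polynomial.eval_monomial, map_smul, smul_eq_mul, mul_comm]

/-- The sets of vertices, with indices up to `m + 2` and both end vertices among them, for which
membership of the inner vertices changes at most `d - 2` times. -/
def IsCoherentVertexSet (d m : ℕ) (A : Finset ℕ) : Prop :=
  0 ∈ A ∧ m + 2 ∈ A ∧ (∀ k ∈ A, k ≤ m + 2) ∧ numChanges A m + 2 ≤ d

/-- The coherent monotone edge paths are the paths through the sets in `IsCoherentVertexSet`: both
conditions say that some functional has that set as its lower hull. -/
theorem coherent_edge_path_iff (ht : StrictMono t)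
    (σ : List (Set (EuclideanSpace ℝ (Fin d)))) :
    ((IsCellularString (momentPolytope d t (m + 2)) (firstCoord hd) (momentPoint d (t 0))
        (momentPoint d (t (m + 2))) σ ∧
      ∀ F ∈ σ, IsPolytopeEdge (momentPolytope d t (m + 2)) F) ∧
      IsCoherentString (momentPolytope d t (m + 2)) (firstCoord hd) σ) ↔
    ∃ A, IsCoherentVertexSet d m A ∧ σ = vertexPath d t A := by
  constructor
  · rintro ⟨⟨hσ, hedge⟩, f, hf⟩
    obtain ⟨A, h0, hN, hA, rfl⟩ := exists_vertexPath hd ht hσ hedge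
    refine ⟨A, ⟨h0, hN, hA, ?_⟩, rfl⟩
    have hull := hasLowerHull_of_maximal hd ht hA fun i j hij =>
      (hf _).1 ((mem_vertexPath_iff A _).2 ⟨i, j, hij, rfl⟩)
    obtain ⟨p, hp, hpf⟩ := exists_polynomial_eval_eq f
    simp only [← hpf] at hull
    have := hull.numChanges_le ht p h0 hN
    omega
  · rintro ⟨A, ⟨h0, hN, hA, hc⟩, rfl⟩
    obtain ⟨f, hull⟩ := exists_linear_hasLowerHull ht h0 hN hA hc
    have hface := fun i j hij => (hull.isPolytopeFace_momentSegment hd hA (i := i) (j := j) hij).1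
    refine ⟨⟨isCellularString_vertexPath hd ht h0 hN (by omega) hA hface, fun F hF => ?_⟩, f,
      fun F => ?_⟩
    · obtain ⟨i, j, hij, rfl⟩ := (mem_vertexPath_iff A F).1 hF
      refine ⟨hface i j hij, finrank_vectorSpan_segment fun h => ?_⟩
      have := congrArg (firstCoord hd) h
      simp only [firstCoord_momentPoint] at this
      exact (ht hij.2.2.1).ne this
    · rw [mem_vertexPath_iff, hull.maximal_iff hd ht h0 hN (by omega) hA]

/-- The signs of the inner vertices `1, …, m + 1`: `-` for those in `A`. -/
def vertexSign (A : Finset ℕ) (m : ℕ) : Fin (m + 1) → SignType :=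
  fun k => if k.val + 1 ∈ A then -1 else 1

/-- The vertex set with prescribed signs of the inner vertices, containing both end vertices. -/
def vertexSetOfSign (s : Fin (m + 1) → SignType) : Finset ℕ :=
  insert 0 (insert (m + 2) ((Finset.univ.filter fun k => s k = -1).image fun k => k.val + 1))

theorem stringSign_vertexPath (ht : StrictMono t) {A : Finset ℕ} (h0 : 0 ∈ A) (hN : m + 2 ∈ A) :
    stringSign (n := m + 3) (firstCoord hd) (fun i => momentPoint d (t i)) (vertexPath d t A) =
      vertexSign A m := by
  funext k
  have hk : k.val < m + 1 := k.isLt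
  simp only [stringSign, vertexSign]
  by_cases hA : k.val + 1 ∈ A
  · obtain ⟨i, j, hc, hi, hj⟩ := exists_consecutive h0 hN (show k.val + 1 < m + 2 by omega)
    obtain rfl : i = k.val + 1 := by
      rcases hc.le_or_le hA with h | h <;> omega
    have hF := (mem_vertexPath_iff (d := d) (t := t) A _).2 ⟨_, j, hc, rfl⟩
    have hmem : momentPoint d (t (k.val + 1)) ∈ momentSegment d t (k.val + 1) j :=
      left_mem_segment ℝ _ _
    have hleast := (isLeast_isGreatest_image_momentSegment (d := d) hd ht hc.2.2.1).1
    have hmin : ∀ x ∈ momentSegment d t (k.val + 1) j,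
        firstCoord hd (momentPoint d (t (k.val + 1))) ≤ firstCoord hd x := fun x hx =>
      (firstCoord_momentPoint hd _).le.trans (hleast.2 ⟨x, hx, rfl⟩)
    rw [if_neg fun h => h _ hF hmem, if_pos ⟨_, hF, hmem, Or.inl hmin⟩, if_pos hA]
  · have hout : ∀ F ∈ vertexPath d t A, momentPoint d (t (k.val + 1)) ∉ F := by
      intro F hF h
      obtain ⟨i, j, hc, rfl⟩ := (mem_vertexPath_iff A F).1 hF
      rcases eq_or_eq_of_mem_momentSegment hd ht h with h | h
      · exact hA (h ▸ hc.1)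
      · exact hA (h ▸ hc.2.1)
    rw [if_pos hout, if_neg hA]

theorem numRuns_vertexSign (A : Finset ℕ) (m : ℕ) :
    numRuns (vertexSign A m) = numChanges A m + 1 := by
  rw [numRuns_eq, numChanges]
  congr 1
  refine Finset.card_bij (fun k _ => k.val) ?_ (fun a _ b _ h => Fin.ext h) ?_
  · intro k hk
    simp only [Finset.mem_filter, Finset.mem_univ, true_and] at hk
    simp only [vertexSign, Fin.val_castSucc, Fin.val_succ] at hk
    simp only [Finset.mem_filter, Finset.mem_range, k.isLt, true_and]
    intro h
    exact hk (by simp only [h])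
  · intro k hk
    simp only [Finset.mem_filter, Finset.mem_range] at hk
    refine ⟨⟨k, hk.1⟩, ?_, rfl⟩
    simp only [Finset.mem_filter, Finset.mem_univ, true_and]
    simp only [vertexSign, Fin.val_castSucc, Fin.val_succ]
    have h := hk.2
    revert h
    by_cases h1 : k + 1 ∈ A <;> by_cases h2 : k + 1 + 1 ∈ A <;> simp [h1, h2]

theorem vertexSign_vertexSetOfSign {s : Fin (m + 1) → SignType} (hs : ∀ i, s i ≠ 0) :
    vertexSign (vertexSetOfSign s) m = s := by
  funext k
  have hk := k.isLt
  have hiff : k.val + 1 ∈ vertexSetOfSign s ↔ s k = -1 := by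
    simp only [vertexSetOfSign, Finset.mem_insert, Finset.mem_image, Finset.mem_filter,
      Finset.mem_univ, true_and]
    constructor
    · rintro (h | h | ⟨l, hl, h⟩)
      · omega
      · omega
      · rwa [← Fin.ext (show l.val = k.val by omega)]
    · exact fun h => Or.inr (Or.inr ⟨k, h, rfl⟩)
  have hx : ∀ x : SignType, x ≠ 0 → x ≠ -1 → x = 1 := by decide
  simp only [vertexSign, hiff]
  by_cases h : s k = -1
  · rw [if_pos h, h]
  · rw [if_neg h, hx _ (hs k) h]

theorem vertexSetOfSign_vertexSign {A : Finset ℕ} (h0 : 0 ∈ A) (hN : m + 2 ∈ A)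
    (hA : ∀ k ∈ A, k ≤ m + 2) : vertexSetOfSign (vertexSign A m) = A := by
  ext k
  simp only [vertexSetOfSign, Finset.mem_insert, Finset.mem_image, Finset.mem_filter,
    Finset.mem_univ, true_and]
  simp only [vertexSign]
  have hx : ∀ l, ((if l + 1 ∈ A then -1 else 1 : SignType) = -1) ↔ l + 1 ∈ A := by
    intro l
    by_cases h : l + 1 ∈ A <;> simp [h]
  constructor
  · rintro (rfl | rfl | ⟨l, hl, rfl⟩)
    · exact h0
    · exact hN
    · exact (hx _).1 hl
  · intro hk
    have := hA k hk
    by_cases h1 : k = 0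
    · exact Or.inl h1
    by_cases h2 : k = m + 2
    · exact Or.inr (Or.inl h2)
    obtain ⟨l, rfl⟩ := Nat.exists_eq_succ_of_ne_zero h1
    exact Or.inr (Or.inr ⟨⟨l, by omega⟩, (hx _).2 hk, rfl⟩)

theorem vertexSign_ne_zero (A : Finset ℕ) (k : Fin (m + 1)) : vertexSign A m k ≠ 0 := by
  simp only [vertexSign]
  split_ifs <;> decide

theorem isCoherentVertexSet_vertexSetOfSign (hd : 2 ≤ d) {s : Fin (m + 1) → SignType}
    (hs : ∀ i, s i ≠ 0) (hr : numRuns s ≤ d - 1) :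
    IsCoherentVertexSet d m (vertexSetOfSign s) := by
  refine ⟨by simp [vertexSetOfSign], by simp [vertexSetOfSign], fun k hk => ?_, ?_⟩
  · simp only [vertexSetOfSign, Finset.mem_insert, Finset.mem_image] at hk
    rcases hk with rfl | rfl | ⟨l, -, rfl⟩
    · omega
    · omega
    · have := l.isLt
      omega
  · rw [← vertexSign_vertexSetOfSign hs, numRuns_vertexSign] at hr
    omega

end

/-- Every increasing finite sequence of reals extends to an increasing infinite one. -/
theorem exists_strictMono_extension {m : ℕ} {t : Fin (m + 1) → ℝ} (ht : StrictMono t) :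
    ∃ T : ℕ → ℝ, StrictMono T ∧ ∀ i : Fin (m + 1), T i = t i := by
  refine ⟨fun k => if h : k < m + 1 then t ⟨k, h⟩ else t (Fin.last m) + k,
    strictMono_nat_of_lt_succ fun k => ?_, fun i => by simp [i.isLt]⟩
  by_cases h1 : k < m + 1
  · by_cases h2 : k + 1 < m + 1
    · simp only [h1, h2, dif_pos]
      exact ht (Fin.mk_lt_mk.2 (Nat.lt_succ_self k))
    · simp only [h1, h2, dif_pos, dif_neg, not_false_eq_true]
      have := ht.monotone (Fin.le_last ⟨k, h1⟩)
      push_cast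
      have : (0 : ℝ) ≤ k := Nat.cast_nonneg k
      linarith
  · have h2 : ¬ k + 1 < m + 1 := by omega
    simp only [h1, h2, dif_neg, not_false_eq_true]
    push_cast
    linarith

theorem mainTheorem6 (n d : ℕ) (hd : 2 ≤ d) (hn : d + 1 ≤ n) (t : Fin n → ℝ)
    (ht : StrictMono t) :
    (∀ s : Fin (n - 2) → SignType, (∀ i, s i ≠ 0) →
      ((∃ σ ∈ coherentMonotoneEdgePaths hd hn t,
          stringSign (firstCoord hd) (fun i => momentPoint d (t i)) σ = s) ↔
        numRuns s ≤ d - 1)) ∧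
    (coherentMonotoneEdgePaths hd hn t).ncard =
      2 * ∑ j ∈ Finset.range (d - 1), (n - 3).choose j := by
  obtain ⟨m, rfl⟩ : ∃ m, n = m + 3 := ⟨n - 3, by omega⟩
  obtain ⟨T, hT, hTt⟩ := exists_strictMono_extension ht
  obtain rfl : t = fun i => T i.val := funext fun i => (hTt i).symm
  have hP : cyclicPolytope d (fun i : Fin (m + 3) => T i.val) = momentPolytope d T (m + 2) := by
    rw [cyclicPolytope, momentPolytope]
    congr 1
    ext x
    constructor
    · rintro ⟨i, rfl⟩
      exact ⟨i.val, Nat.lt_succ_iff.1 i.isLt, rfl⟩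
    · rintro ⟨k, hk, rfl⟩
      exact ⟨⟨k, Nat.lt_succ_of_le hk⟩, rfl⟩
  have hmem : ∀ σ, σ ∈ coherentMonotoneEdgePaths hd hn (fun i : Fin (m + 3) => T i.val) ↔
      ∃ A, IsCoherentVertexSet d m A ∧ σ = vertexPath d T A := by
    intro σ
    rw [← coherent_edge_path_iff hd hT, ← hP]
    rfl
  have hsign : ∀ A, IsCoherentVertexSet d m A →
      stringSign (n := m + 3) (firstCoord hd) (fun i => momentPoint d (T i.val))
        (vertexPath d T A) = vertexSign A m := fun A hA =>
    stringSign_vertexPath hd hT hA.1 hA.2.1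
  refine ⟨fun s hs => ⟨?_, fun hr => ?_⟩, ?_⟩
  · rintro ⟨σ, hσ, rfl⟩
    obtain ⟨A, hA, rfl⟩ := (hmem σ).1 hσ
    have h := numRuns_vertexSign A m
    rw [← hsign A hA] at h
    have hc := hA.2.2.2
    exact h.le.trans (by omega)
  · have hA := isCoherentVertexSet_vertexSetOfSign (m := m) hd hs hr
    exact ⟨_, (hmem _).2 ⟨_, hA, rfl⟩, (hsign _ hA).trans (vertexSign_vertexSetOfSign hs)⟩
  · have himage : coherentMonotoneEdgePaths hd hn (fun i : Fin (m + 3) => T i.val) =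
        (fun s => vertexPath d T (vertexSetOfSign s)) ''
          {s : Fin (m + 1) → SignType | (∀ i, s i ≠ 0) ∧ numRuns s ≤ d - 1} := by
      ext σ
      rw [hmem]
      constructor
      · rintro ⟨A, hA, rfl⟩
        refine ⟨vertexSign A m, ⟨vertexSign_ne_zero A, ?_⟩, ?_⟩
        · have hc := hA.2.2.2
          rw [numRuns_vertexSign]
          omega
        · simp only [vertexSetOfSign_vertexSign hA.1 hA.2.1 hA.2.2.1]
      · rintro ⟨s, ⟨hs, hr⟩, rfl⟩
        exact ⟨_, isCoherentVertexSet_vertexSetOfSign hd hs hr, rfl⟩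
    rw [himage, Set.InjOn.ncard_image, ncard_setOf_numRuns_lt]
    · rfl
    · rintro s ⟨hs, hr⟩ s' ⟨hs', hr'⟩ h
      have h1 := hsign _ (isCoherentVertexSet_vertexSetOfSign hd hs hr)
      have h2 := hsign _ (isCoherentVertexSet_vertexSetOfSign hd hs' hr')
      rw [vertexSign_vertexSetOfSign hs] at h1
      rw [vertexSign_vertexSetOfSign hs'] at h2
      simp only at h
      rw [← h1, h, h2]
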